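/- **Proposition (Absorbing path).** *Definitions.* Let $H=(V,E)$ be a $3$-uniform hypergraph with $|V|=n$. Let $d_H(v)$ be the number of hyperedges containing $v$, and $\delta(H)=\min_v d_H(v)$. For $v\in V$ the link graph $L_v$ is the graph on $V$ with edge set $\{yz : vyz\in E\}$. A tight $(x,y)$-$(z,w)$-path in $H$ is a sequence of distinct vertices $x_1x_2\dots x_{k+2}$ such that $\{x_i,x_{i+1},x_{i+2}\}\in E$ for all $1\le i\le k$, with $(x_1,x_2)=(x,y)$ and $(x_{k+1},x_{k+2})=(z,w)$. These two ordered pairs are its end-pairs, $k$ is its length, and all its other vertices are internal. A graph $R$ is $(\beta,\ell)$-robust if any two distinct vertices $x,y$ of $R$ are joined by at least $\beta|V(R)|^{\ell-1}$ paths of length $\ell$ in $R$. *Setup.* Let $\alpha,\beta>0$, let $\ell\ge 3$ be an odd integer, let $\delta(H)\ge(\frac59+\alpha)\frac{n^2}{2}$, and for every $v\in V$ let $R_v$ be an induced subgraph of $L_v$ such that * $|V(R_v)|\ge(\frac23+\frac\alpha2)n$; * at most $\alpha n^2/4$ edges of $L_v$ join $V(R_v)$ to $V\setminus V(R_v)$,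 and $e(R_v)\ge(\frac59+\frac\alpha2)\frac{n^2}2-\frac{(n-|V(R_v)|)^2}2$; * $R_v$ is $(\beta,\ell)$-robust. For $\zeta>0$, a pair $xy$ is $\zeta$-connectable if $|\{v\in V : xy\in E(R_v)\}|\ge\zeta n$; an ordered pair $(x,y)$ is $\zeta$-connectable if $xy$ is. Given $\theta_*,\zeta_{**},\theta_{**}>0$, a set $\mathcal R\subseteq V$ is a reservoir if $\frac{\theta_*^2}{2}n\le|\mathcal R|\le\theta_*^2n$ and for any two disjoint $\zeta_{**}$-connectable pairs $(x,y)$, $(z,w)$ there are at least $\frac12\theta_{**}|\mathcal R|^{3\ell+1}$ tight $(x,y)$-$(z,w)$-paths of length $3(\ell+1)$ in $H$ all of whose internal vertices lie in $\mathcal R$. *Statement.* There is $\alpha_0>0$ such that for every $0<\alpha\le\alpha_0$ there is $\zeta_0=\zeta_0(\alpha)>0$ such that for all $0<\zeta_*\le\zeta_0$, all $\beta>0$ and all odd $\ell\ge3$ there is $\theta_0=\theta_0(\alpha,\zeta_*,\beta,\ell)>0$ such that for all $0<\theta_*\le\theta_0$ and all $\zeta_{**},\theta_{**}>0$ there is $n_0$,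 depending on all these constants, with the following property. For every $3$-uniform hypergraph $H=(V,E)$ on $n\ge n_0$ vertices with subgraphs $R_v\subseteq L_v$ as in the setup, and for every reservoir $\mathcal R\subseteq V$, there is a tight path $P_A$ in $H$ with $V(P_A)\cap\mathcal R=\varnothing$ such that 1. $|V(P_A)|\le\theta_*n$; 2. both end-pairs of $P_A$ are $\zeta_*$-connectable; 3. for every set $X\subseteq V\setminus V(P_A)$ with $|X|\le2\theta_*^2n$ there is a tight path in $H$ whose vertex set is $V(P_A)\cup X$ and whose end-pairs are the same as those of $P_A$. -/

import Mathlib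

/-- A `3`-uniform hypergraph whose vertex set is the whole type `V`. -/
structure Hypergraph3 (V : Type*) extends Hypergraph V where
  vertexSet_eq : vertexSet = Set.univ
  ncard_eq_three : ∀ e ∈ edgeSet, e.ncard = 3

namespace Hypergraph3

variable {V : Type*} (H : Hypergraph3 V)

/-- The degree of `v`: the number of hyperedges containing `v`. -/
noncomputable def degree (v : V) : ℕ := {e ∈ H.edgeSet | v ∈ e}.ncard

/-- The minimum vertex degree `δ(H)`. -/
noncomputable def minDegree : ℕ := ⨅ v, H.degree v

/-- The link graph `L_v` on the vertex set `V`: `yz` is an edge iff `vyz` is a hyperedge. -/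
def link (v : V) : SimpleGraph V where
  Adj y z := ({v, y, z} : Set V) ∈ H.edgeSet
  symm := ⟨fun y z h => by rwa [Set.pair_comm z y]⟩
  loopless := ⟨fun y h => by
    have h3 := H.ncard_eq_three _ h
    have h2 := Set.ncard_insert_le v {y}
    rw [Set.pair_eq_singleton] at h3
    rw [Set.ncard_singleton] at h2
    omega⟩

/-- `H.IsTightPath x y z w P`: the vertex sequence `P` is a tight `(x, y)`-`(z, w)`-path in `H`,
that is, its vertices are distinct, it starts with `x, y`, it ends with `z, w`, and any three
consecutive vertices form a hyperedge of `H`. Its length (number of hyperedges) is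
`P.length - 2`. -/
structure IsTightPath (x y z w : V) (P : List V) : Prop where
  nodup : P.Nodup
  start_pair : [x, y] <+: P
  end_pair : [z, w] <:+ P
  edge : ∀ a b c : V, [a, b, c] <:+: P → ({a, b, c} : Set V) ∈ H.edgeSet

end Hypergraph3

namespace SimpleGraph

variable {V : Type*}

/-- `e_G(A, B)`: the number of edges of `G` with one vertex in `A` and one in `B`. -/
noncomputable def numEdgesBetween (G : SimpleGraph V) (A B : Set V) : ℕ :=
  {e ∈ G.edgeSet | ∃ a ∈ A, ∃ b ∈ B, e = s(a, b)}.ncard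

/-- `(β, ℓ)`-robustness: any two distinct vertices `x, y` are joined by at least
`β |V(R)|^(ℓ-1)` paths of length `ℓ`. -/
def IsRobust (R : SimpleGraph V) (β : ℝ) (l : ℕ) : Prop :=
  ∀ x y : V, x ≠ y →
    β * (Nat.card V : ℝ) ^ (l - 1) ≤ ({p : R.Path x y | p.1.length = l}.ncard : ℝ)

/-- `R` is a `(β, ℓ)`-robust induced subgraph of the graph `L`, with many vertices and edges and
with few edges of `L` leaving it (measured by `α` and by `n = |V|`). -/
structure IsRobustSubgraph (L : SimpleGraph V) (α β : ℝ) (l : ℕ) (R : L.Subgraph) : Prop where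
  induced : R.IsInduced
  card_verts : (2 / 3 + α / 2) * (Nat.card V : ℝ) ≤ (R.verts.ncard : ℝ)
  card_leaving : (L.numEdgesBetween R.verts R.vertsᶜ : ℝ) ≤ α * (Nat.card V : ℝ) ^ 2 / 4
  card_edges : (5 / 9 + α / 2) * ((Nat.card V : ℝ) ^ 2 / 2)
    - ((Nat.card V : ℝ) - (R.verts.ncard : ℝ)) ^ 2 / 2 ≤ (R.edgeSet.ncard : ℝ)
  robust : R.coe.IsRobust β l

end SimpleGraph

namespace Hypergraph3

variable {V : Type*} (H : Hypergraph3 V)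

/-- A pair `xy` is `ζ`-connectable, with respect to chosen subgraphs `R_v ⊆ L_v`, if it is an edge
of `R_v` for at least `ζ |V|` vertices `v`. -/
def IsConnectable (R : ∀ v, (H.link v).Subgraph) (ζ : ℝ) (x y : V) : Prop :=
  ζ * (Nat.card V : ℝ) ≤ ({v | (R v).Adj x y}.ncard : ℝ)

/-- `S` is a reservoir set: `θ₁² n / 2 ≤ |S| ≤ θ₁² n`, and for any two disjoint `ζ₂`-connectable
pairs `(x, y)` and `(z, w)` there are at least `θ₂ |S|^(3ℓ+1) / 2` tight `(x, y)`-`(z, w)`-paths of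
length `3(ℓ+1)` in `H` all of whose internal vertices lie in `S`. -/
structure IsReservoir (R : ∀ v, (H.link v).Subgraph) (l : ℕ) (θ₁ ζ₂ θ₂ : ℝ) (S : Set V) :
    Prop where
  card_ge : θ₁ ^ 2 / 2 * (Nat.card V : ℝ) ≤ (S.ncard : ℝ)
  card_le : (S.ncard : ℝ) ≤ θ₁ ^ 2 * (Nat.card V : ℝ)
  connecting : ∀ x y z w : V, H.IsConnectable R ζ₂ x y → H.IsConnectable R ζ₂ z w →
    Disjoint ({x, y} : Set V) {z, w} →
    θ₂ * (S.ncard : ℝ) ^ (3 * l + 1) / 2 ≤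
      ({P : List V | H.IsTightPath x y z w P ∧ P.length = 3 * (l + 1) + 2 ∧
        ∀ u ∈ P, u ∉ ({x, y, z, w} : Set V) → u ∈ S}.ncard : ℝ)

end Hypergraph3

/-! ### Tight sequences, weaving, and the combinatorics of absorption -/

section TightLists

variable {V : Type*}

/-- Any three consecutive entries of the list satisfy `E`. -/
def TightList (E : V → V → V → Prop) : List V → Prop
  | a :: b :: c :: l => E a b c ∧ TightList E (b :: c :: l)
  | _ => True

theorem TightList.of_infix {E : V → V → V → Prop} {P : List V} (h : TightList E P) {a b c : V}
    (hi : [a, b, c] <:+: P) : E a b c := by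
  obtain ⟨s, t, rfl⟩ := hi
  induction s with
  | nil => exact h.1
  | cons x s ih =>
    apply ih
    rcases s with _ | ⟨y, _ | ⟨z, s⟩⟩
    · exact h.2
    · exact h.2
    · exact h.2

theorem TightList.append {E : V → V → V → Prop} {l₁ l₂ : List V} {a b : V}
    (h₁ : TightList E (l₁ ++ [a, b])) (h₂ : TightList E (a :: b :: l₂)) :
    TightList E (l₁ ++ a :: b :: l₂) := by
  induction l₁ with
  | nil => exact h₂
  | cons x l ih =>
    rcases l with _ | ⟨y, _ | ⟨z, l⟩⟩
    · exact ⟨h₁.1, h₂⟩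
    · exact ⟨h₁.1, ih h₁.2⟩
    · exact ⟨h₁.1, ih h₁.2⟩

/-- A walk `x, y, r₁, …, r₂ₖ, p, q` in the common link of `k + 1` vertices yields a tight path from
`(x, y)` to `(p, q)`. -/
theorem exists_tightList_of_isChain {E K : V → V → V → Prop}
    (hK : ∀ u a b, K u a b → E a b u ∧ E a u b ∧ E u a b) (us : List V) (hus : us ≠ []) (p q : V) :
    ∀ (r : List V) (x y : V), r.length + 2 = 2 * us.length →
      (∀ u ∈ us, List.IsChain (K u) ([x, y] ++ r ++ [p, q])) →
      ∃ M, M.Perm (r ++ us) ∧ TightList E ([x, y] ++ M ++ [p, q]) := by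
  induction us with
  | nil => exact absurd rfl hus
  | cons u us ih =>
    intro r x y hl hc
    rcases us with _ | ⟨u', us⟩
    · obtain rfl : r = [] := by
        apply List.eq_nil_of_length_eq_zero
        simpa using hl
      have h := hc u (by simp)
      simp only [List.append_nil, List.cons_append, List.nil_append, List.isChain_cons_cons] at h
      exact ⟨[u], by simp, (hK _ _ _ h.1).1, (hK _ _ _ h.2.1).2.1, (hK _ _ _ h.2.2.1).2.2, trivial⟩
    · rcases r with _ | ⟨r₁, _ | ⟨r₂, r⟩⟩
      · simp at hl
      · simp at hl
        omega
      · have h := hc u (by simp)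
        simp only [List.cons_append, List.nil_append, List.isChain_cons_cons] at h
        obtain ⟨M, hM, hT⟩ := ih (by simp) r r₁ r₂ (by simp at hl ⊢; omega) (by
          intro v hv
          have h := hc v (by simp at hv ⊢; tauto)
          simp only [List.cons_append, List.nil_append, List.isChain_cons_cons] at h ⊢
          exact h.2.2)
        -- The woven sequence is x y u r₁ r₂ u' …, with one apex after every two walk vertices. So
        -- any three consecutive terms are an apex together with a walk edge in its link; the three
        -- orders in `hK` are the three possible positions of the apex.
        refine ⟨u :: r₁ :: r₂ :: M, ?_, ?_⟩
        · have : (r₁ :: r₂ :: r ++ u :: u' :: us).Perm (u :: (r₁ :: r₂ :: r ++ u' :: us)) :=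
            List.perm_middle
          refine List.Perm.trans ?_ this.symm
          exact ((hM.cons _).cons _).cons _
        · exact ⟨(hK _ _ _ h.1).1, (hK _ _ _ h.2.1).2.1, (hK _ _ _ h.2.2.1).2.2, hT⟩

/-- `P` can absorb, for any system of distinct representatives outside `P` of some of the sets in
`A`, all these representatives, while keeping the end-pairs `(x, y)` and `(z, w)`. -/
def IsAbsorbing (E : V → V → V → Prop) (x y z w : V) (P : List V) (A : List (Set V)) : Prop :=
  ∀ B : List (Option V), List.Forall₂ (fun S o => ∀ v ∈ o, v ∈ S) A B →
    (P ++ B.reduceOption).Nodup →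
    ∃ Q, TightList E Q ∧ [x, y] <+: Q ∧ [z, w] <:+ Q ∧ Q.Perm (P ++ B.reduceOption)

theorem isAbsorbing_pair (E : V → V → V → Prop) (x y : V) : IsAbsorbing E x y x y [x, y] [] := by
  intro B hB _
  obtain rfl := List.forall₂_nil_left_iff.1 hB
  exact ⟨[x, y], trivial, List.prefix_rfl, List.suffix_rfl, by simp⟩

/-- Only the end-pair (z, w) of Q takes part in the gluing, so the same connector M fits whatever Q
has become through earlier absorptions. -/
theorem TightList.extend {E : V → V → V → Prop} {x y z w : V} {M : List V} {a b : V}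
    {l : List V} {c d : V}
    (hM : TightList E ([z, w] ++ M ++ [a, b])) (hl : TightList E (a :: b :: l ++ [c, d]))
    {Q : List V} (hQ : TightList E Q) (hx : [x, y] <+: Q) (hz : [z, w] <:+ Q) :
    TightList E (Q ++ M ++ (a :: b :: l ++ [c, d])) ∧
      [x, y] <+: (Q ++ M ++ (a :: b :: l ++ [c, d])) ∧
      [c, d] <:+ (Q ++ M ++ (a :: b :: l ++ [c, d])) := by
  obtain ⟨Q', rfl⟩ := hz
  refine ⟨?_, ?_, ?_⟩
  · have h1 : TightList E (z :: w :: M ++ a :: b :: (l ++ [c, d])) := by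
      apply TightList.append
      · simpa using hM
      · simpa using hl
    have h2 : TightList E (Q' ++ z :: w :: (M ++ a :: b :: (l ++ [c, d]))) :=
      TightList.append hQ (by simpa using h1)
    simpa using h2
  · rw [List.append_assoc]
    exact hx.trans (List.prefix_append _ _)
  · rw [← List.append_assoc]
    exact List.suffix_append _ _

/-- An absorber: the tight paths `a b u c d` and `a' b' c' d'` absorb a vertex `v` by turning into
`a b v c d` and `a' b' u c' d'`. -/
theorem IsAbsorbing.append {E : V → V → V → Prop} {x y z w : V} {P : List V} {A : List (Set V)}
    (h : IsAbsorbing E x y z w P A) {M M' : List V} {a b u c d a' b' c' d' : V}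
    (hM : TightList E ([z, w] ++ M ++ [a, b])) (hM' : TightList E ([c, d] ++ M' ++ [a', b']))
    (hl : TightList E [a, b, u, c, d]) (hl' : TightList E [a', b', c', d'])
    (hu : TightList E [a', b', u, c', d']) :
    IsAbsorbing E x y c' d' (P ++ M ++ [a, b, u, c, d] ++ M' ++ [a', b', c', d'])
      ({v | TightList E [a, b, v, c, d]} :: A) := by
  intro B hB hnd
  obtain ⟨o, B', ho, hB', rfl⟩ := List.forall₂_cons_left_iff.1 hB
  have hnd' : (P ++ B'.reduceOption).Nodup := by
    refine hnd.sublist ?_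
    refine List.Sublist.append ?_ ?_
    · simp only [List.append_assoc]
      exact List.sublist_append_left _ _
    · cases o <;> simp
  obtain ⟨Q, hQ, hx, hz, hQP⟩ := h B' hB' hnd'
  cases o with
  | none =>
    obtain ⟨h1, h2, h3⟩ := TightList.extend (l := [u]) hM hl hQ hx hz
    obtain ⟨h4, h5, h6⟩ := TightList.extend (l := []) hM' hl' h1 h2 h3
    refine ⟨_, h4, h5, h6, ?_⟩
    classical
    rw [List.perm_iff_count] at hQP ⊢
    intro e
    have := hQP e
    simp only [List.count_append, List.reduceOption_cons_of_none, List.count_cons,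
      List.cons_append, List.nil_append] at this ⊢
    omega
  | some v =>
    have hv : TightList E [a, b, v, c, d] := ho v rfl
    obtain ⟨h1, h2, h3⟩ := TightList.extend (l := [v]) hM hv hQ hx hz
    obtain ⟨h4, h5, h6⟩ := TightList.extend (l := [u]) hM' hu h1 h2 h3
    refine ⟨_, h4, h5, h6, ?_⟩
    classical
    rw [List.perm_iff_count] at hQP ⊢
    intro e
    have := hQP e
    simp only [List.count_append, List.reduceOption_cons_of_some, List.count_cons,
      List.cons_append, List.nil_append] at this ⊢
    omega

/-- If every entry of `X` lies in at least `|X|` of the sets in `A`, then `X` is a system of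
distinct representatives of some of the sets in `A`. -/
theorem exists_forall₂_reduceOption_perm [DecidableEq V] (A : List (Set V))
    [∀ (v : V) (S : Set V), Decidable (v ∈ S)] (X : List V)
    (h : ∀ v ∈ X, X.length ≤ A.countP (fun S => decide (v ∈ S))) :
    ∃ B : List (Option V), List.Forall₂ (fun S o => ∀ v ∈ o, v ∈ S) A B ∧
      B.reduceOption.Perm X := by
  induction A generalizing X with
  | nil =>
    rcases X with _ | ⟨v, X⟩
    · exact ⟨[], List.Forall₂.nil, by simp⟩
    · have := h v (by simp)
      simp at this
  | cons S A ih =>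
    -- Greedy matching: if S contains a vertex still to be placed, using S for it shortens X by one
    -- and lowers every count by at most one. Otherwise S contributed to none of the counts.
    by_cases hS : ∃ v ∈ X, v ∈ S
    · obtain ⟨v, hv, hvS⟩ := hS
      obtain ⟨B, hB, hBX⟩ := ih (X.erase v) (by
        intro w hw
        have h1 := h w (List.mem_of_mem_erase hw)
        rw [List.countP_cons] at h1
        rw [List.length_erase_of_mem hv]
        split_ifs at h1 <;> omega)
      refine ⟨some v :: B, List.Forall₂.cons (by simpa using hvS) hB, ?_⟩
      rw [List.reduceOption_cons_of_some]
      exact (hBX.cons v).trans (List.perm_cons_erase hv).symm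
    · push Not at hS
      obtain ⟨B, hB, hBX⟩ := ih X (by
        intro w hw
        have h1 := h w hw
        rw [List.countP_cons_of_neg (by simpa using hS w hw)] at h1
        exact h1)
      exact ⟨none :: B, List.Forall₂.cons (by simp) hB, by simpa using hBX⟩

end TightLists

/-! ### Counting degenerate tuples, and averaging -/

section Counting

open Finset

open scoped Classical

theorem pow_succ_sub_pow_succ_le {m n : ℝ} (hm : 0 ≤ m) (hmn : m ≤ n) (k : ℕ) :
    n ^ (k + 1) - m ^ (k + 1) ≤ (k + 1) * (n - m) * n ^ k := by
  induction k with
  | zero => simp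
  | succ k ih =>
    have h1 : m ^ (k + 1) ≤ n ^ (k + 1) := pow_le_pow_left₀ hm hmn _
    have h2 := mul_le_mul_of_nonneg_left ih (hm.trans hmn)
    have h3 := mul_le_mul_of_nonneg_left h1 (sub_nonneg.2 hmn)
    push_cast
    calc n ^ (k + 1 + 1) - m ^ (k + 1 + 1)
        = n * (n ^ (k + 1) - m ^ (k + 1)) + (n - m) * m ^ (k + 1) := by ring
      _ ≤ n * ((k + 1) * (n - m) * n ^ k) + (n - m) * n ^ (k + 1) := add_le_add h2 h3
      _ = _ := by ring

theorem card_filter_injective_avoiding {V : Type*} [Fintype V] (k : ℕ) (F : Finset V) :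
    #{t : Fin k → V | Function.Injective t ∧ ∀ i, t i ∉ F} =
      (Fintype.card V - #F).descFactorial k := by
  have h : Fintype.card (Fin k ↪ {x // x ∉ F}) = (Fintype.card V - #F).descFactorial k := by
    rw [Fintype.card_embedding_eq, Fintype.card_fin]
    congr 1
    rw [Fintype.card_subtype_compl, Fintype.card_coe]
  rw [← h, ← Fintype.card_coe]
  refine Fintype.card_congr ⟨fun t => ⟨fun i => ⟨t.1 i, ?_⟩, ?_⟩,
    fun e => ⟨fun i => (e i).1, ?_⟩, fun t => ?_, fun e => ?_⟩
  · exact (mem_filter.1 t.2).2.2 i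
  · intro i j hij
    exact (mem_filter.1 t.2).2.1 (by simpa using hij)
  · simp only [mem_filter, mem_univ, true_and]
    exact ⟨fun i j hij => e.injective (Subtype.ext hij), fun i => (e i).2⟩
  · rfl
  · rfl

/-- Few `k`-tuples fail to be injective or meet a small set `F`. -/
theorem card_filter_not_injective_or_meets_le {V : Type*} [Fintype V] (k : ℕ) (F : Finset V) :
    (#{t : Fin k → V | ¬ (Function.Injective t ∧ ∀ i, t i ∉ F)} : ℝ) ≤
      k * (#F + k) * (Fintype.card V : ℝ) ^ (k - 1) := by
  rcases k with _ | k
  · rw [Finset.filter_false_of_mem]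
    · simp
    · intro t _
      push Not
      exact ⟨fun i => i.elim0, fun i => i.elim0⟩
  · set n := Fintype.card V
    have htot : #{t : Fin (k + 1) → V | Function.Injective t ∧ ∀ i, t i ∉ F} +
        #{t : Fin (k + 1) → V | ¬ (Function.Injective t ∧ ∀ i, t i ∉ F)} = n ^ (k + 1) := by
      rw [Finset.card_filter_add_card_filter_not]
      simp [n]
    have htot' := congrArg (Nat.cast : ℕ → ℝ) htot
    push_cast at htot'
    rw [card_filter_injective_avoiding] at htot'
    have hF : #F ≤ n := card_le_univ F
    by_cases hn : #F + (k + 1) ≤ n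
    · have h1 : ((n - #F + 1 - (k + 1) : ℕ) : ℝ) ^ (k + 1) ≤
          ((n - #F).descFactorial (k + 1) : ℝ) := by
        exact_mod_cast Nat.pow_sub_le_descFactorial (n - #F) (k + 1)
      have h2 : (n : ℝ) - (#F + (k + 1)) ≤ ((n - #F + 1 - (k + 1) : ℕ) : ℝ) := by
        have : n ≤ (n - #F + 1 - (k + 1)) + (#F + (k + 1)) := by omega
        have : (n : ℝ) ≤ ((n - #F + 1 - (k + 1) : ℕ) : ℝ) + (#F + (k + 1)) := by exact_mod_cast this
        linarith
      have h3 : (0 : ℝ) ≤ (n : ℝ) - (#F + (k + 1)) := by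
        have : ((#F + (k + 1) : ℕ) : ℝ) ≤ n := by exact_mod_cast hn
        push_cast at this
        linarith
      have h4 := pow_le_pow_left₀ h3 h2 (k + 1)
      have h5 := pow_succ_sub_pow_succ_le h3 (n := n) (by linarith [Nat.cast_nonneg (α := ℝ) #F]) k
      have h6 : (n : ℝ) - (n - (#F + (k + 1))) = #F + (k + 1) := by ring
      rw [h6] at h5
      push_cast
      linarith
    · have h1 : (n : ℝ) ≤ #F + (k + 1) := by
        have : n ≤ #F + (k + 1) := by omega
        exact_mod_cast this
      push_cast
      calc (#{t : Fin (k + 1) → V | ¬ (Function.Injective t ∧ ∀ i, t i ∉ F)} : ℝ)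
          ≤ (n : ℝ) ^ (k + 1) := by
            rw [← htot']
            exact le_add_of_nonneg_left (Nat.cast_nonneg _)
        _ = 1 * n * n ^ k := by ring
        _ ≤ (k + 1) * (#F + (k + 1)) * n ^ k := by
            gcongr
            linarith [Nat.cast_nonneg (α := ℝ) k]

theorem exists_card_filter_ge {I J : Type*} [Fintype J] [Nonempty J] (W : Finset I)
    (P : I → J → Prop) (κ : ℝ)
    (h : ∀ i ∈ W, κ * Fintype.card J ≤ (#{j | P i j} : ℝ)) :
    ∃ j, κ * #W ≤ (#{i ∈ W | P i j} : ℝ) := by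
  by_contra! hc
  have h1 : ∑ j : J, (#{i ∈ W | P i j} : ℝ) < ∑ j : J, κ * #W :=
    sum_lt_sum_of_nonempty univ_nonempty fun j _ => hc j
  have h2 : ∑ i ∈ W, κ * Fintype.card J ≤ ∑ i ∈ W, (#{j | P i j} : ℝ) := sum_le_sum h
  have h3 : ∑ i ∈ W, (#{j | P i j} : ℝ) = ∑ j : J, (#{i ∈ W | P i j} : ℝ) := by
    exact_mod_cast sum_card_bipartiteAbove_eq_sum_card_bipartiteBelow (s := W) (t := univ) P
  simp only [sum_const, nsmul_eq_mul, card_univ] at h1 h2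
  nlinarith

theorem card_filter_mem_or_mem_le {V : Type*} [Fintype V] (F : Finset V) :
    (#{e : V × V | e.1 ∈ F ∨ e.2 ∈ F} : ℝ) ≤ 2 * #F * Fintype.card V := by
  have h : ({e : V × V | e.1 ∈ F ∨ e.2 ∈ F} : Finset (V × V)) ⊆ F ×ˢ univ ∪ univ ×ˢ F := by
    intro e
    simp
  have h2 := (card_le_card h).trans (card_union_le _ _)
  simp only [card_product, card_univ] at h2
  have h3 : (#{e : V × V | e.1 ∈ F ∨ e.2 ∈ F} : ℝ) ≤
      #F * Fintype.card V + Fintype.card V * #F := by exact_mod_cast h2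
  linarith

end Counting

/-! ### Ordered edge counts of graphs and links -/

section Graphs

open Finset

open scoped Classical

variable {V : Type*} [Fintype V]

theorem card_filter_adj (G : SimpleGraph V) :
    #{e : V × V | G.Adj e.1 e.2} = 2 * G.edgeSet.ncard := by
  have h := G.dart_card_eq_twice_card_edges
  rw [← SimpleGraph.coe_edgeFinset, Set.ncard_coe_finset, ← h, ← Fintype.card_coe]
  refine Fintype.card_congr ⟨fun e => ⟨e.1, (mem_filter.1 e.2).2⟩, fun d => ⟨d.toProd, by
    simp⟩, fun e => rfl, fun d => rfl⟩

theorem SimpleGraph.Subgraph.card_filter_adj {L : SimpleGraph V} (R : L.Subgraph) :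
    #{e : V × V | R.Adj e.1 e.2} = 2 * R.edgeSet.ncard := by
  rw [← SimpleGraph.Subgraph.edgeSet_spanningCoe, ← _root_.card_filter_adj]
  simp

theorem SimpleGraph.card_filter_adj_between_le (L : SimpleGraph V) (A : Set V) :
    #{e : V × V | L.Adj e.1 e.2 ∧ e.1 ∈ A ∧ e.2 ∉ A} ≤ L.numEdgesBetween A Aᶜ := by
  rw [SimpleGraph.numEdgesBetween, ← Set.ncard_coe_finset]
  refine Set.ncard_le_ncard_of_injOn (fun e => s(e.1, e.2)) ?_ ?_ (Set.toFinite _)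
  · rintro ⟨a, b⟩ h
    simp only [coe_filter, mem_univ, true_and, Set.mem_ofPred_eq] at h
    exact ⟨h.1, a, h.2.1, b, h.2.2, rfl⟩
  · rintro ⟨a, b⟩ h ⟨c, d⟩ h' hh
    simp only [coe_filter, mem_univ, true_and, Set.mem_ofPred_eq] at h h'
    simp only [Sym2.eq_iff] at hh
    rcases hh with ⟨rfl, rfl⟩ | ⟨rfl, rfl⟩
    · rfl
    · exact absurd h.2.1 h'.2.2

theorem Hypergraph3.degree_le_ncard_edgeSet_link (H : Hypergraph3 V) (v : V) :
    H.degree v ≤ (H.link v).edgeSet.ncard := by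
  have h : {e ∈ H.edgeSet | v ∈ e} ⊆
      (fun s : Sym2 V => insert v (s : Set V)) '' (H.link v).edgeSet := by
    rintro e ⟨he, hv⟩
    have h3 := H.ncard_eq_three e he
    obtain ⟨a, b, c, hab, hac, hbc, rfl⟩ := Set.ncard_eq_three.1 h3
    simp only [Set.mem_insert_iff, Set.mem_singleton_iff] at hv
    rcases hv with rfl | rfl | rfl
    · exact ⟨s(b, c), he, by ext; simp⟩
    · refine ⟨s(a, c), ?_, by ext; simp; tauto⟩
      change ({v, a, c} : Set V) ∈ H.edgeSet
      rwa [Set.insert_comm]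
    · refine ⟨s(a, b), ?_, by ext; simp; tauto⟩
      change ({v, a, b} : Set V) ∈ H.edgeSet
      rwa [Set.insert_comm, Set.pair_comm v b]
  exact (Set.ncard_le_ncard h (Set.toFinite _)).trans (Set.ncard_image_le (Set.toFinite _))

omit [Fintype V] in
theorem Hypergraph3.minDegree_le_degree (H : Hypergraph3 V) (v : V) : H.minDegree ≤ H.degree v :=
  ciInf_le (OrderBot.bddBelow _) v

end Graphs

/-! ### Connecting two pairs that lie in many common links -/

section Connecting

open Finset

open scoped Classical

universe u

/-- A path between fixed ends is determined by its interior vertices, so robustness becomes a count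
of k-tuples in `V`, which can be compared between different vertices u. -/
theorem SimpleGraph.Subgraph.le_card_filter_isChain {V : Type*} [Fintype V] {L : SimpleGraph V}
    (R : L.Subgraph) {β : ℝ} {k : ℕ} (hR : R.coe.IsRobust β (k + 1)) {y p : V} (hy : y ∈ R.verts)
    (hp : p ∈ R.verts) (hyp : y ≠ p) :
    β * (R.verts.ncard : ℝ) ^ k ≤
      (#{r : Fin k → V | List.IsChain R.Adj (y :: (List.ofFn r ++ [p]))} : ℝ) := by
  have h := hR ⟨y, hy⟩ ⟨p, hp⟩ (by simpa using hyp)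
  rw [Nat.add_sub_cancel, Nat.card_coe_set_eq] at h
  refine h.trans ?_
  rw [← Set.ncard_coe_finset, Nat.cast_le]
  refine Set.ncard_le_ncard_of_injOn
    (fun P : R.coe.Path ⟨y, hy⟩ ⟨p, hp⟩ => fun i : Fin k => ((P.1.getVert (i + 1) : R.verts) : V))
    ?_ ?_ (Set.toFinite _)
  · intro P hP
    have hP : P.1.length = k + 1 := hP
    simp only [coe_filter, mem_univ, true_and, Set.mem_ofPred_eq]
    have h1 : y :: (List.ofFn (fun i : Fin k => ((P.1.getVert (i + 1) : R.verts) : V)) ++ [p]) =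
        List.ofFn (fun i : Fin (k + 2) => ((P.1.getVert i : R.verts) : V)) := by
      rw [List.ofFn_succ, List.ofFn_succ_last]
      have : P.1.getVert (k + 1) = ⟨p, hp⟩ := by
        rw [← hP]
        exact P.1.getVert_length
      simp [this]
    rw [h1, List.isChain_ofFn]
    intro i hi
    exact P.1.adj_getVert_succ (i := i) (by omega)
  · intro P hP Q hQ hPQ
    have hP : P.1.length = k + 1 := hP
    have hQ : Q.1.length = k + 1 := hQ
    refine Subtype.ext (SimpleGraph.Walk.ext_getVert fun i => ?_)
    rcases Nat.eq_zero_or_pos i with rfl | hi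
    · simp
    · by_cases hik : i ≤ k
      · have := congrFun hPQ ⟨i - 1, by omega⟩
        simp only [Nat.sub_add_cancel hi] at this
        exact Subtype.ext this
      · rw [P.1.getVert_of_length_le (by omega), Q.1.getVert_of_length_le (by omega)]

theorem Hypergraph3.link_adj_rotate {V : Type*} (H : Hypergraph3 V) (u a b : V)
    (h : (H.link u).Adj a b) :
    ({a, b, u} : Set V) ∈ H.edgeSet ∧ ({a, u, b} : Set V) ∈ H.edgeSet ∧
      ({u, a, b} : Set V) ∈ H.edgeSet := by
  have h : ({u, a, b} : Set V) ∈ H.edgeSet := h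
  refine ⟨?_, ?_, h⟩
  · rwa [Set.pair_comm b u, Set.insert_comm]
  · rwa [Set.insert_comm]

/-- The hyperedge relation of `H` on ordered triples. -/
def Hypergraph3.Rel {V : Type*} (H : Hypergraph3 V) (a b c : V) : Prop :=
  ({a, b, c} : Set V) ∈ H.edgeSet

/-- Each u in `W` sees a positive proportion of all 2m-tuples as interiors of paths from y to p in
R_u. By pigeonhole one tuple r serves linearly many u. Then m + 1 of these, outside F and r, are
woven into the walk x, y, r, p, q, giving 2m + (m + 1) inner vertices. -/
theorem exists_connection_of_common_links (β : ℝ) (hβ : 0 < β) (m : ℕ) (c : ℝ) (hc : 0 < c) :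
    ∃ ε : ℝ, 0 < ε ∧ ∃ n₀ : ℕ, ∀ (V : Type u) [Fintype V], n₀ ≤ Fintype.card V →
      ∀ (H : Hypergraph3 V) (R : ∀ v, (H.link v).Subgraph),
      (∀ v, (R v).coe.IsRobust β (2 * m + 1)) →
      (∀ v, 2 / 3 * (Fintype.card V : ℝ) ≤ ((R v).verts.ncard : ℝ)) →
      ∀ (x y p q : V) (F : Finset V), y ≠ p → (#F : ℝ) ≤ ε * Fintype.card V →
      ∀ W : Finset V, c * Fintype.card V ≤ #W → (∀ u ∈ W, (R u).Adj x y ∧ (R u).Adj p q) →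
      ∃ M : List V, M.length = 3 * m + 1 ∧ M.Nodup ∧ (∀ v ∈ M, v ∉ F) ∧
        TightList H.Rel ([x, y] ++ M ++ [p, q]) := by
  -- Since R_u has at least 2n/3 vertices, robustness gives at least 2κ times n to the power 2m
  -- tuples; half is reserved for those that repeat a vertex or meet F.
  obtain ⟨κ, hκ⟩ : ∃ κ, κ = β * (2 / 3) ^ (2 * m) / 2 := ⟨_, rfl⟩
  have hκ0 : 0 < κ := by rw [hκ]; positivity
  obtain ⟨n₁, hn₁⟩ := exists_nat_gt (max (8 * (m : ℝ) ^ 2 / κ) ((3 * m + 1) / (κ * c / 2)))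
  refine ⟨min (κ / (4 * (m + 1))) (κ * c / 2), by positivity, n₁, ?_⟩
  intro V _ hn H R hR hcard x y p q F hyp hF W hW hWadj
  set n := Fintype.card V
  have hn' : (n₁ : ℝ) ≤ n := by exact_mod_cast hn
  have hn1 : 8 * (m : ℝ) ^ 2 < κ * n := by
    have := (le_max_left _ _).trans_lt hn₁
    rw [div_lt_iff₀ hκ0] at this
    nlinarith
  have hn2 : (3 * m + 1 : ℝ) < κ * c / 2 * n := by
    have := (le_max_right _ _).trans_lt hn₁
    rw [div_lt_iff₀ (by positivity)] at this
    nlinarith [mul_pos hκ0 hc]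
  have hn0 : (0 : ℝ) < n := by
    by_contra h
    have : (n : ℝ) = 0 := le_antisymm (not_lt.1 h) (Nat.cast_nonneg _)
    rw [this] at hn2
    have : (0 : ℝ) ≤ m := Nat.cast_nonneg _
    linarith
  have hF1 : (#F : ℝ) * (4 * (m + 1)) ≤ κ * n := by
    have h1 := hF.trans (mul_le_mul_of_nonneg_right (min_le_left _ _) hn0.le)
    rw [div_mul_eq_mul_div, le_div_iff₀ (by positivity)] at h1
    exact h1
  have hF2 : (#F : ℝ) ≤ κ * c / 2 * n :=
    hF.trans (mul_le_mul_of_nonneg_right (min_le_right _ _) hn0.le)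
  have : Nonempty V := Fintype.card_pos_iff.1 (by exact_mod_cast hn0)
  obtain ⟨T, hT⟩ : ∃ T : V → (Fin (2 * m) → V) → Prop, ∀ u r, T u r ↔
      List.IsChain (R u).Adj (y :: (List.ofFn r ++ [p])) ∧ Function.Injective r ∧ ∀ i, r i ∉ F :=
    ⟨_, fun _ _ => Iff.rfl⟩
  obtain ⟨r, hr⟩ := exists_card_filter_ge W T κ (by
      intro u hu
      have h1 := (R u).le_card_filter_isChain (hR u) (hWadj u hu).1.snd_mem
        (hWadj u hu).2.fst_mem hyp
      have h2 := card_filter_not_injective_or_meets_le (2 * m) F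
      have h3 : #{r : Fin (2 * m) → V | List.IsChain (R u).Adj (y :: (List.ofFn r ++ [p]))} ≤
          #{r : Fin (2 * m) → V | T u r} +
          #{r : Fin (2 * m) → V | ¬ (Function.Injective r ∧ ∀ i, r i ∉ F)} := by
        rw [← card_filter_add_card_filter_not (s := filter _ _)
          (fun r : Fin (2 * m) → V => Function.Injective r ∧ ∀ i, r i ∉ F), filter_filter,
          filter_filter]
        gcongr with r r
        · exact fun h => (hT _ _).2 h
        · exact fun h => h.2
      have h3' : (#{r : Fin (2 * m) → V | List.IsChain (R u).Adj (y :: (List.ofFn r ++ [p]))} : ℝ) ≤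
          #{r : Fin (2 * m) → V | T u r} +
          #{r : Fin (2 * m) → V | ¬ (Function.Injective r ∧ ∀ i, r i ∉ F)} := by exact_mod_cast h3
      have h4 : 2 * κ * (n : ℝ) ^ (2 * m) ≤ β * ((R u).verts.ncard : ℝ) ^ (2 * m) := by
        rw [hκ]
        calc 2 * (β * (2 / 3) ^ (2 * m) / 2) * (n : ℝ) ^ (2 * m)
            = β * (2 / 3 * (n : ℝ)) ^ (2 * m) := by rw [mul_pow]; ring
          _ ≤ _ := by
            gcongr
            exact hcard u
      have h5 : ((2 * m : ℕ) : ℝ) * (#F + (2 * m : ℕ)) * (n : ℝ) ^ (2 * m - 1) ≤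
          κ * (n : ℝ) ^ (2 * m) := by
        rcases Nat.eq_zero_or_pos m with rfl | hm
        · simp
          exact hκ0.le
        · have : (n : ℝ) ^ (2 * m) = n * (n : ℝ) ^ (2 * m - 1) := by
            rw [← pow_succ']
            congr 1
            omega
          rw [this, ← mul_assoc]
          refine mul_le_mul_of_nonneg_right ?_ (by positivity)
          push_cast
          have : (0 : ℝ) ≤ #F := Nat.cast_nonneg _
          linarith
      rw [Fintype.card_fun, Fintype.card_fin]
      push_cast
      change κ * (n : ℝ) ^ (2 * m) ≤ _
      linarith)
  obtain ⟨U, hUsub, hUcard⟩ : ∃ U ⊆ {u ∈ W | T u r} \ (F ∪ univ.image r), #U = m + 1 := by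
    apply exists_subset_card_eq
    have h1 := le_card_sdiff (F ∪ univ.image r) {u ∈ W | T u r}
    refine le_trans ?_ h1
    have h2 : #(F ∪ univ.image r) ≤ #F + 2 * m := by
      refine (card_union_le _ _).trans ?_
      have := card_image_le (s := univ) (f := r)
      simp at this
      omega
    have h3 : (#F : ℝ) + 3 * m + 1 ≤ #{u ∈ W | T u r} := by
      refine le_trans ?_ hr
      nlinarith
    have h3' : #F + 3 * m + 1 ≤ #{u ∈ W | T u r} := by exact_mod_cast h3
    omega
  have hU : ∀ u ∈ U, (u ∈ W ∧ List.IsChain (R u).Adj (y :: (List.ofFn r ++ [p])) ∧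
      Function.Injective r ∧ ∀ i, r i ∉ F) ∧ u ∉ F ∧ ∀ i, r i ≠ u := by
    intro u hu
    simpa [hT] using hUsub hu
  obtain ⟨u₀, hu₀⟩ : U.Nonempty := card_pos.1 (by omega)
  obtain ⟨M, hM, hMT⟩ := exists_tightList_of_isChain (E := H.Rel)
    (K := fun u a b => (R u).Adj a b)
    (fun u a b h => H.link_adj_rotate u a b h.adj_sub) U.toList
    (by simpa using (card_pos.1 (by omega : 0 < #U)).ne_empty) p q (List.ofFn r) x y (by simp [hUcard]; ring) (by
      intro u hu
      have h := hU u (by simpa using hu)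
      have h' := hWadj u h.1.1
      have h1 : [x, y] ++ List.ofFn r ++ [p, q] =
        (x :: (y :: (List.ofFn r ++ [p]))) ++ [q] := by simp
      rw [h1]
      refine List.isChain_append.2 ⟨List.isChain_cons_cons.2 ⟨h'.1, h.1.2.1⟩, by simp, ?_⟩
      intro a ha b hb
      rw [← List.cons_append, ← List.cons_append, List.getLast?_concat] at ha
      simp at ha hb
      subst ha hb
      exact h'.2)
  refine ⟨M, ?_, ?_, ?_, hMT⟩
  · rw [hM.length_eq]
    simp [hUcard]
    ring
  · rw [hM.nodup_iff, List.nodup_append]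
    refine ⟨List.nodup_ofFn.2 (hU u₀ hu₀).1.2.2.1, nodup_toList _, ?_⟩
    intro a ha b hb
    rw [List.mem_ofFn] at ha
    obtain ⟨i, rfl⟩ := ha
    exact (hU b (by simpa using hb)).2.2 i
  · intro v hv
    rw [hM.mem_iff, List.mem_append, List.mem_ofFn] at hv
    rcases hv with ⟨i, rfl⟩ | hv
    · exact (hU u₀ hu₀).1.2.2.2 i
    · exact (hU v (by simpa using hv)).2.1

end Connecting

/-! ### Common edges, and connecting two connectable pairs -/

section Connecting

open Finset

open scoped Classical

universe u

/-- All ordered edges of the two graphs lie in A × A ∪ B × B, whose size is a² + b² - s² with s = |A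
∩ B| ≥ a + b - n. Inclusion–exclusion leaves at least (1/9 + α)n² - (a - b)² common ones, and |a -
b| ≤ n/3 because both sizes lie between 2n/3 and n. -/
theorem common_edges_bound {α n a b s e f t i : ℝ} (hα : 0 < α) (hn : 0 ≤ n)
    (ha : a ≤ n) (hb : b ≤ n)
    (ha' : (2 / 3 + α / 2) * n ≤ a) (hb' : (2 / 3 + α / 2) * n ≤ b)
    (he : (5 / 9 + α / 2) * (n ^ 2 / 2) - (n - a) ^ 2 / 2 ≤ e)
    (hf : (5 / 9 + α / 2) * (n ^ 2 / 2) - (n - b) ^ 2 / 2 ≤ f) (hs : a + b - n ≤ s)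
    (ht : t + s * s ≤ a * a + b * b) (hi : t + i = 2 * e + 2 * f) : α * n ^ 2 ≤ i := by
  have hαn : 0 ≤ α * n := mul_nonneg hα.le hn
  have h1 : (a + b - n) ^ 2 ≤ s ^ 2 := by
    apply pow_le_pow_left₀ <;> linarith
  have h2 : (a - b) ^ 2 ≤ (n / 3) ^ 2 := by
    apply sq_le_sq' <;> linarith
  linarith

/-- Any two of the robust subgraphs have many common edges. -/
theorem SimpleGraph.IsRobustSubgraph.le_card_filter_adj_adj {V : Type*} [Fintype V]
    {L L' : SimpleGraph V} {α β : ℝ} (hα : 0 < α) {l : ℕ} {R : L.Subgraph} {R' : L'.Subgraph}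
    (h : L.IsRobustSubgraph α β l R) (h' : L'.IsRobustSubgraph α β l R') :
    α * (Fintype.card V : ℝ) ^ 2 ≤ (#{e : V × V | R.Adj e.1 e.2 ∧ R'.Adj e.1 e.2} : ℝ) := by
  obtain ⟨A, hA⟩ : ∃ A : Finset V, R.verts = A := ⟨R.verts.toFinset, by simp⟩
  obtain ⟨B, hB⟩ : ∃ B : Finset V, R'.verts = B := ⟨R'.verts.toFinset, by simp⟩
  have h1 := h.card_edges
  have h2 := h'.card_edges
  have h3 := h.card_verts
  have h4 := h'.card_verts
  rw [hA, Set.ncard_coe_finset, Nat.card_eq_fintype_card] at h1 h3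
  rw [hB, Set.ncard_coe_finset, Nat.card_eq_fintype_card] at h2 h4
  have h5 : (#{e : V × V | R.Adj e.1 e.2} : ℝ) = 2 * R.edgeSet.ncard := by
    exact_mod_cast R.card_filter_adj
  have h6 : (#{e : V × V | R'.Adj e.1 e.2} : ℝ) = 2 * R'.edgeSet.ncard := by
    exact_mod_cast R'.card_filter_adj
  have h7 : #(univ.filter (fun e : V × V => R.Adj e.1 e.2) ∪ univ.filter (fun e : V × V => R'.Adj e.1 e.2)) +
      #(A ∩ B) * #(A ∩ B) ≤ #A * #A + #B * #B := by
    rw [← card_product, ← card_product, ← card_product, ← card_union_add_card_inter (A ×ˢ A),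
      product_inter_product]
    gcongr
    · intro e he
      have he : R.Adj e.1 e.2 := (mem_filter.1 he).2
      have : e.1 ∈ R.verts ∧ e.2 ∈ R.verts := ⟨he.fst_mem, he.snd_mem⟩
      simpa [hA] using this
    · intro e he
      have he : R'.Adj e.1 e.2 := (mem_filter.1 he).2
      have : e.1 ∈ R'.verts ∧ e.2 ∈ R'.verts := ⟨he.fst_mem, he.snd_mem⟩
      simpa [hB] using this
  have h8 := card_union_add_card_inter (univ.filter fun e : V × V => R.Adj e.1 e.2)
    (univ.filter fun e : V × V => R'.Adj e.1 e.2)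
  rw [← filter_and] at h8
  have h9 := card_union_add_card_inter A B
  have h10 : #(A ∪ B) ≤ Fintype.card V := card_le_univ _
  have hAn : (#A : ℝ) ≤ Fintype.card V := by exact_mod_cast card_le_univ A
  have hBn : (#B : ℝ) ≤ Fintype.card V := by exact_mod_cast card_le_univ B
  have h9' : (#(A ∪ B) : ℝ) + #(A ∩ B) = #A + #B := by exact_mod_cast h9
  have h10' : (#(A ∪ B) : ℝ) ≤ Fintype.card V := by exact_mod_cast h10
  have h8' := congrArg (Nat.cast : ℕ → ℝ) h8
  have h7' : (#(univ.filter (fun e : V × V => R.Adj e.1 e.2) ∪ univ.filter (fun e : V × V => R'.Adj e.1 e.2)) : ℝ) +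
      #(A ∩ B) * #(A ∩ B) ≤ #A * #A + #B * #B := by exact_mod_cast h7
  push_cast at h8'
  rw [h5, h6] at h8'
  exact common_edges_bound hα (Nat.cast_nonneg _) hAn hBn h3 h4 h1 h2
    (by linarith) h7' h8'

/-- Let U and W be the sets of vertices whose graphs contain xy and zw. Every pair in U × W has many
common edges off F, so some pq lies in the graphs of an α/2 proportion of such pairs, hence of that
proportion of U and of W. Connecting (x, y) to (p, q) through U and (p, q) to (z, w) through W gives
2(3m + 1) + 2 inner vertices. -/
theorem exists_connection (α β ζ : ℝ) (hα : 0 < α) (hβ : 0 < β) (hζ : 0 < ζ) (m : ℕ) :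
    ∃ ε : ℝ, 0 < ε ∧ ∃ n₀ : ℕ, ∀ (V : Type u) [Fintype V], n₀ ≤ Fintype.card V →
      ∀ (H : Hypergraph3 V) (R : ∀ v, (H.link v).Subgraph),
      (∀ v, (H.link v).IsRobustSubgraph α β (2 * m + 1) (R v)) →
      ∀ (x y z w : V), H.IsConnectable R ζ x y → H.IsConnectable R ζ z w →
      ∀ F : Finset V, x ∈ F → y ∈ F → z ∈ F → w ∈ F → (#F : ℝ) ≤ ε * Fintype.card V →
      ∃ M : List V, M.length = 6 * m + 4 ∧ M.Nodup ∧ (∀ v ∈ M, v ∉ F) ∧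
        TightList H.Rel ([x, y] ++ M ++ [z, w]) := by
  obtain ⟨ε, hε, n₀, hn₀⟩ := exists_connection_of_common_links.{u} β hβ m (α / 2 * ζ)
    (by positivity)
  obtain ⟨n₁, hn₁⟩ := exists_nat_gt ((3 * m + 3) / (ε / 2))
  refine ⟨min (ε / 2) (α / 4), by positivity, max (max n₀ n₁) 1, ?_⟩
  intro V _ hn H R hR x y z w hxy hzw F hx hy hz hw hF
  have hcard : ∀ v, 2 / 3 * (Fintype.card V : ℝ) ≤ ((R v).verts.ncard : ℝ) := by
    intro v
    have := (hR v).card_verts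
    rw [Nat.card_eq_fintype_card] at this
    refine le_trans ?_ this
    gcongr
    linarith
  have key := fun x y p q F => hn₀ V (by omega) H R (fun v => (hR v).robust) hcard x y p q F
  set n := Fintype.card V
  have hn1 : (1 : ℝ) ≤ n := by exact_mod_cast (le_max_right _ _).trans hn
  have hnn : (n₁ : ℝ) ≤ n := by
    have : n₁ ≤ n := by omega
    exact_mod_cast this
  have hn2 : (3 * m + 3 : ℝ) ≤ ε / 2 * n := by
    rw [div_lt_iff₀ (by positivity)] at hn₁
    nlinarith
  have hF1 : (#F : ℝ) ≤ ε / 2 * n :=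
    hF.trans (mul_le_mul_of_nonneg_right (min_le_left _ _) (by linarith))
  have hF2 : (#F : ℝ) ≤ α / 4 * n :=
    hF.trans (mul_le_mul_of_nonneg_right (min_le_right _ _) (by linarith))
  have : Nonempty V := ⟨x⟩
  obtain ⟨U, hU, hUmem⟩ : ∃ U : Finset V, ζ * n ≤ #U ∧ ∀ u, u ∈ U ↔ (R u).Adj x y := by
    refine ⟨univ.filter fun u => (R u).Adj x y, ?_, by simp⟩
    rw [Hypergraph3.IsConnectable, Nat.card_eq_fintype_card] at hxy
    rwa [← Set.ncard_coe_finset, coe_filter_univ]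
  obtain ⟨W, hW, hWmem⟩ : ∃ W : Finset V, ζ * n ≤ #W ∧ ∀ u, u ∈ W ↔ (R u).Adj z w := by
    refine ⟨univ.filter fun u => (R u).Adj z w, ?_, by simp⟩
    rw [Hypergraph3.IsConnectable, Nat.card_eq_fintype_card] at hzw
    rwa [← Set.ncard_coe_finset, coe_filter_univ]
  have hU0 : (0 : ℝ) < #U := lt_of_lt_of_le (by positivity) hU
  have hW0 : (0 : ℝ) < #W := lt_of_lt_of_le (by positivity) hW
  obtain ⟨T, hT⟩ : ∃ T : V × V → V × V → Prop, ∀ i e, T i e ↔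
      (R i.1).Adj e.1 e.2 ∧ (R i.2).Adj e.1 e.2 ∧ e.1 ∉ F ∧ e.2 ∉ F := ⟨_, fun _ _ => Iff.rfl⟩
  obtain ⟨⟨p, q⟩, hpq⟩ := exists_card_filter_ge (U ×ˢ W) T (α / 2) (by
    rintro ⟨i, j⟩ -
    have h1 := (hR i).le_card_filter_adj_adj hα (hR j)
    have h2 := card_filter_mem_or_mem_le F
    have h3 : #{e : V × V | (R i).Adj e.1 e.2 ∧ (R j).Adj e.1 e.2} ≤
        #{e | T (i, j) e} + #{e : V × V | e.1 ∈ F ∨ e.2 ∈ F} := by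
      refine le_trans (card_le_card ?_) (card_union_le _ _)
      intro e he
      simp only [mem_filter, mem_univ, true_and, mem_union, hT] at he ⊢
      tauto
    have h3' : (#{e : V × V | (R i).Adj e.1 e.2 ∧ (R j).Adj e.1 e.2} : ℝ) ≤
        #{e | T (i, j) e} + #{e : V × V | e.1 ∈ F ∨ e.2 ∈ F} := by exact_mod_cast h3
    rw [Fintype.card_prod]
    push_cast
    change α / 2 * ((n : ℝ) * n) ≤ _
    change α * (n : ℝ) ^ 2 ≤ _ at h1
    change _ ≤ 2 * (#F : ℝ) * n at h2
    nlinarith)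
  rw [card_product] at hpq
  push_cast at hpq
  have hpos : (0 : ℝ) < #{i ∈ U ×ˢ W | T i (p, q)} := lt_of_lt_of_le (by positivity) hpq
  obtain ⟨⟨i₀, j₀⟩, hij⟩ := card_pos.1 (by exact_mod_cast hpos)
  rw [mem_filter, hT] at hij
  obtain ⟨hpF, hqF⟩ := hij.2.2.2
  have hU1 : α / 2 * #U ≤ (#{u ∈ U | (R u).Adj p q} : ℝ) := by
    have h1 : {i ∈ U ×ˢ W | T i (p, q)} ⊆ {u ∈ U | (R u).Adj p q} ×ˢ W := by
      intro i hi
      simp only [mem_filter, mem_product, hT] at hi ⊢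
      tauto
    have h2 := card_le_card h1
    rw [card_product] at h2
    have h2' : (#{i ∈ U ×ˢ W | T i (p, q)} : ℝ) ≤ #{u ∈ U | (R u).Adj p q} * #W := by
      exact_mod_cast h2
    have h3 : (α / 2 * #U) * #W ≤ (#{u ∈ U | (R u).Adj p q} : ℝ) * #W := by linarith
    exact le_of_mul_le_mul_right h3 hW0
  have hW1 : α / 2 * #W ≤ (#{u ∈ W | (R u).Adj p q} : ℝ) := by
    have h1 : {i ∈ U ×ˢ W | T i (p, q)} ⊆ U ×ˢ {u ∈ W | (R u).Adj p q} := by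
      intro i hi
      simp only [mem_filter, mem_product, hT] at hi ⊢
      tauto
    have h2 := card_le_card h1
    rw [card_product] at h2
    have h2' : (#{i ∈ U ×ˢ W | T i (p, q)} : ℝ) ≤ #U * #{u ∈ W | (R u).Adj p q} := by
      exact_mod_cast h2
    have h3 : (α / 2 * #W) * #U ≤ (#{u ∈ W | (R u).Adj p q} : ℝ) * #U := by linarith
    exact le_of_mul_le_mul_right h3 hU0
  have hpqne : p ≠ q := hij.2.1.ne
  obtain ⟨M, hMl, hMn, hMF, hMT⟩ := key x y p q (insert p (insert q F))
    (fun h => hpF (h ▸ hy)) (by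
      have := (card_insert_le p (insert q F)).trans (Nat.succ_le_succ (card_insert_le q F))
      have : (#(insert p (insert q F)) : ℝ) ≤ #F + 2 := by exact_mod_cast this
      have : (0 : ℝ) ≤ m := Nat.cast_nonneg _
      linarith) {u ∈ U | (R u).Adj p q} (by
      refine le_trans ?_ hU1
      rw [mul_assoc]
      gcongr) (by
      intro u hu
      rw [mem_filter, hUmem] at hu
      exact hu)
  obtain ⟨N, hNl, hNn, hNF, hNT⟩ := key p q z w (insert p (insert q F) ∪ M.toFinset)
    (fun h => hqF (h ▸ hz)) (by
      have h1 := (card_insert_le p (insert q F)).trans (Nat.succ_le_succ (card_insert_le q F))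
      have h2 := card_union_le (insert p (insert q F)) M.toFinset
      have h3 := List.toFinset_card_le M
      have : #(insert p (insert q F) ∪ M.toFinset) ≤ #F + (3 * m + 3) := by omega
      have : (#(insert p (insert q F) ∪ M.toFinset) : ℝ) ≤ #F + (3 * m + 3) := by
        exact_mod_cast this
      linarith) {u ∈ W | (R u).Adj p q} (by
      refine le_trans ?_ hW1
      rw [mul_assoc]
      gcongr) (by
      intro u hu
      rw [mem_filter, hWmem] at hu
      exact hu.symm)
  refine ⟨M ++ p :: q :: N, ?_, ?_, ?_, ?_⟩
  · simp [hMl, hNl]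
    ring
  · simp only [mem_insert, not_or, mem_union, List.mem_toFinset] at hMF hNF
    rw [List.nodup_append]
    refine ⟨hMn, ?_, ?_⟩
    · simp only [List.nodup_cons, List.mem_cons, not_or]
      exact ⟨⟨hpqne, fun h => (hNF p h).1.1 rfl⟩, fun h => (hNF q h).1.2.1 rfl, hNn⟩
    · intro a ha b hb
      simp only [List.mem_cons] at hb
      rcases hb with rfl | rfl | hb
      · exact (hMF a ha).1
      · exact (hMF a ha).2.1
      · rintro rfl
        exact (hNF a hb).2 ha
  · intro v hv
    simp only [mem_insert, not_or, mem_union, List.mem_toFinset] at hMF hNF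
    simp only [List.mem_append, List.mem_cons] at hv
    rcases hv with hv | rfl | rfl | hv
    · exact (hMF v hv).2.2
    · exact hpF
    · exact hqF
    · exact (hNF v hv).1.2.2
  · have h1 : TightList H.Rel (([x, y] ++ M) ++ p :: q :: (N ++ [z, w])) :=
      TightList.append (by simpa using hMT) (by simpa using hNT)
    simpa using h1

end Connecting

/-! ### Walks of length three in dense relations -/

section Walks

open Finset

open scoped Classical

theorem card_mul_mul_le_card_filter {I A B : Type*} [Fintype I] [Fintype A] [Fintype B]
    (D : Finset I) (P : I → A → Prop) (Q : I → B → Prop)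
    [∀ t : I × A × B, Decidable (t.1 ∈ D ∧ P t.1 t.2.1 ∧ Q t.1 t.2.2)] {k₁ k₂ : ℝ} (hk₁ : 0 ≤ k₁) (hk₂ : 0 ≤ k₂)
    (hP : ∀ i ∈ D, k₁ ≤ (#{a | P i a} : ℝ)) (hQ : ∀ i ∈ D, k₂ ≤ (#{b | Q i b} : ℝ)) :
    #D * k₁ * k₂ ≤ (#{t : I × A × B | t.1 ∈ D ∧ P t.1 t.2.1 ∧ Q t.1 t.2.2} : ℝ) := by
  have h : #(D.sigma fun i => (univ.filter (P i)) ×ˢ (univ.filter (Q i))) ≤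
      #{t : I × A × B | t.1 ∈ D ∧ P t.1 t.2.1 ∧ Q t.1 t.2.2} := by
    refine card_le_card_of_injOn (fun s => (s.1, s.2.1, s.2.2)) ?_ ?_
    · rintro ⟨i, a, b⟩ h
      simpa using h
    · rintro ⟨i, a, b⟩ - ⟨j, c, d⟩ - h
      simp only [Prod.mk.injEq] at h
      obtain ⟨rfl, rfl, rfl⟩ := h
      rfl
  rw [card_sigma] at h
  calc #D * k₁ * k₂ = ∑ i ∈ D, k₁ * k₂ := by rw [sum_const, nsmul_eq_mul, mul_assoc]
    _ ≤ ∑ i ∈ D, (#{a | P i a} : ℝ) * (#{b | Q i b} : ℝ) :=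
        sum_le_sum fun i hi => mul_le_mul (hP i hi) (hQ i hi) hk₂ (hk₁.trans (hP i hi))
    _ = ((∑ i ∈ D, #((univ.filter (P i)) ×ˢ (univ.filter (Q i))) : ℕ) : ℝ) := by
        push_cast [card_product]
        rfl
    _ ≤ _ := by exact_mod_cast h

theorem card_filter_prod_eq_sum {I A : Type*} [Fintype I] [Fintype A] (P : I → A → Prop)
    [∀ i a, Decidable (P i a)] :
    #{t : I × A | P t.1 t.2} = ∑ i, #{a | P i a} := by
  simp only [card_filter]
  rw [Fintype.sum_prod_type]

/-- Few pairs of a symmetric relation start at an element of small degree; hence a dense relation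
has many walks of length three. -/
theorem le_card_filter_walk {V : Type*} [Fintype V] (G : V → V → Prop)
    (hG : ∀ a b, G a b → G b a) {γ : ℝ} (hγ : 0 ≤ γ)
    (h : γ * (Fintype.card V : ℝ) ^ 2 ≤ (#{e : V × V | G e.1 e.2} : ℝ)) :
    γ ^ 3 / 32 * (Fintype.card V : ℝ) ^ 4 ≤
      (#{t : (V × V) × V × V | G t.2.1 t.1.1 ∧ G t.1.1 t.1.2 ∧ G t.1.2 t.2.2} : ℝ) := by
  set n : ℝ := (Fintype.card V : ℝ) with hn
  have hn0 : 0 ≤ n := Nat.cast_nonneg _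
  have hlow : (#{e : V × V | G e.1 e.2 ∧ (#{a | G e.1 a} : ℝ) < γ / 4 * n} : ℝ) ≤
      γ / 4 * n ^ 2 := by
    rw [card_filter_prod_eq_sum fun b c => G b c ∧ (#{a | G b a} : ℝ) < γ / 4 * n]
    push_cast
    calc ∑ b, (#{c | G b c ∧ (#{a | G b a} : ℝ) < γ / 4 * n} : ℝ) ≤ ∑ b : V, γ / 4 * n := by
          refine sum_le_sum fun b _ => ?_
          by_cases hb : (#{a | G b a} : ℝ) < γ / 4 * n
          · refine le_trans ?_ hb.le
            gcongr with c
            exact fun h => h.1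
          · simp only [hb, and_false, filter_false, card_empty, Nat.cast_zero]
            positivity
      _ = γ / 4 * n ^ 2 := by
          rw [sum_const, card_univ, nsmul_eq_mul, ← hn]
          ring
  have hlow' : (#{e : V × V | G e.1 e.2 ∧ (#{a | G e.2 a} : ℝ) < γ / 4 * n} : ℝ) ≤
      γ / 4 * n ^ 2 := by
    refine le_trans ?_ hlow
    rw [Nat.cast_le]
    refine card_le_card_of_injOn Prod.swap ?_ Prod.swap_injective.injOn
    intro e he
    simp only [coe_filter, mem_univ, true_and, Set.mem_ofPred_eq, Prod.fst_swap,
      Prod.snd_swap] at he ⊢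
    exact ⟨hG _ _ he.1, he.2⟩
  obtain ⟨D, hD⟩ : ∃ D : Finset (V × V), ∀ e, e ∈ D ↔ G e.1 e.2 ∧
      γ / 4 * n ≤ (#{a | G e.1 a} : ℝ) ∧ γ / 4 * n ≤ (#{a | G e.2 a} : ℝ) :=
    ⟨univ.filter fun e => G e.1 e.2 ∧
      γ / 4 * n ≤ (#{a | G e.1 a} : ℝ) ∧ γ / 4 * n ≤ (#{a | G e.2 a} : ℝ), by simp⟩
  have hDcard : γ / 2 * n ^ 2 ≤ #D := by
    have h1 : (univ.filter fun e : V × V => G e.1 e.2) ⊆ (D ∪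
        univ.filter fun e : V × V => G e.1 e.2 ∧ (#{a | G e.1 a} : ℝ) < γ / 4 * n) ∪
        univ.filter fun e : V × V => G e.1 e.2 ∧ (#{a | G e.2 a} : ℝ) < γ / 4 * n := by
      intro e he
      have he : G e.1 e.2 := (mem_filter.1 he).2
      simp only [mem_union, mem_filter, mem_univ, true_and, hD, he]
      by_cases h1 : (#{a | G e.1 a} : ℝ) < γ / 4 * n
      · exact Or.inl (Or.inr h1)
      · by_cases h2 : (#{a | G e.2 a} : ℝ) < γ / 4 * n
        · exact Or.inr h2
        · exact Or.inl (Or.inl ⟨not_lt.1 h1, not_lt.1 h2⟩)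
    have h2 := (card_le_card h1).trans ((card_union_le _ _).trans
      (Nat.add_le_add_right (card_union_le _ _) _))
    have h3 : (#{e : V × V | G e.1 e.2} : ℝ) ≤ #D +
        #{e : V × V | G e.1 e.2 ∧ (#{a | G e.1 a} : ℝ) < γ / 4 * n} +
        #{e : V × V | G e.1 e.2 ∧ (#{a | G e.2 a} : ℝ) < γ / 4 * n} := by exact_mod_cast h2
    linarith
  have h1 := card_mul_mul_le_card_filter D (fun e a => G e.1 a) (fun e d => G e.2 d)
    (by positivity : 0 ≤ γ / 4 * n) (by positivity : 0 ≤ γ / 4 * n)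
    (fun e he => ((hD e).1 he).2.1) (fun e he => ((hD e).1 he).2.2)
  calc γ ^ 3 / 32 * n ^ 4 = γ / 2 * n ^ 2 * (γ / 4 * n) * (γ / 4 * n) := by ring
    _ ≤ #D * (γ / 4 * n) * (γ / 4 * n) := by gcongr
    _ ≤ _ := h1
    _ ≤ _ := by
      rw [Nat.cast_le]
      refine card_le_card fun t ht => ?_
      obtain ⟨h1, h2, h3⟩ := (mem_filter.1 ht).2
      exact mem_filter.2 ⟨mem_univ _, hG _ _ h2, ((hD _).1 h1).1, h3⟩

end Walks

/-! ### Connectable pairs, and the two halves of an absorber -/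

section Swap

open Finset

open scoped Classical

variable {V : Type*} [Fintype V] (H : Hypergraph3 V) (R : ∀ v, (H.link v).Subgraph)

omit [Fintype V] in
variable {H R} in
theorem Hypergraph3.IsConnectable.symm {ζ : ℝ} {a b : V} (h : H.IsConnectable R ζ a b) :
    H.IsConnectable R ζ b a := by
  rw [Hypergraph3.IsConnectable] at h ⊢
  simpa only [SimpleGraph.Subgraph.adj_comm] using h

/-- Few edges of the subgraphs `R u` are not connectable. -/
theorem Hypergraph3.card_filter_adj_not_isConnectable_le {ζ : ℝ} (hζ : 0 ≤ ζ) :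
    (#{t : V × V × V | (R t.1).Adj t.2.1 t.2.2 ∧ ¬ H.IsConnectable R ζ t.2.1 t.2.2} : ℝ) ≤
      ζ * (Fintype.card V : ℝ) ^ 3 := by
  have h1 : #{t : V × V × V | (R t.1).Adj t.2.1 t.2.2 ∧ ¬ H.IsConnectable R ζ t.2.1 t.2.2} =
      ∑ e : V × V, #{u | (R u).Adj e.1 e.2 ∧ ¬ H.IsConnectable R ζ e.1 e.2} := by
    simp only [card_filter]
    rw [Fintype.sum_prod_type, sum_comm]
  rw [h1]
  push_cast
  calc ∑ e : V × V, (#{u | (R u).Adj e.1 e.2 ∧ ¬ H.IsConnectable R ζ e.1 e.2} : ℝ)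
      ≤ ∑ e : V × V, ζ * (Fintype.card V : ℝ) := by
        refine sum_le_sum fun e _ => ?_
        by_cases he : H.IsConnectable R ζ e.1 e.2
        · simp only [he, not_true, and_false, filter_false, card_empty, Nat.cast_zero]
          positivity
        · have he' := he
          rw [Hypergraph3.IsConnectable, Nat.card_eq_fintype_card, not_le,
            ← coe_filter_univ, Set.ncard_coe_finset] at he'
          simpa [he] using he'.le
    _ = _ := by
        rw [sum_const, card_univ, nsmul_eq_mul, Fintype.card_prod]
        push_cast
        ring

end Swap

namespace Hypergraph3

variable {V : Type*} (H : Hypergraph3 V)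

variable {H} in
theorem Rel.rotate {a b c : V} (h : H.Rel a b c) : H.Rel b c a :=
  (H.link_adj_rotate a b c h).1

variable {H} in
theorem Rel.swap {a b c : V} (h : H.Rel a b c) : H.Rel b a c :=
  (H.link_adj_rotate a b c h).2.1

variable (R : ∀ v, (H.link v).Subgraph)

/-- The tight path `a b u c d` with connectable end-pairs remains one when `u` is replaced
by `v`. -/
def IsSwap (ζ : ℝ) (u v a b c d : V) : Prop :=
  H.IsConnectable R ζ a b ∧ H.IsConnectable R ζ c d ∧ TightList H.Rel [a, b, u, c, d] ∧
    TightList H.Rel [a, b, v, c, d]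

/-- The tight path `a b c d` with connectable end-pairs remains one when `u` is inserted in its
middle. -/
def IsInsert (ζ : ℝ) (u a b c d : V) : Prop :=
  H.IsConnectable R ζ a b ∧ H.IsConnectable R ζ c d ∧ TightList H.Rel [a, b, c, d] ∧
    TightList H.Rel [a, b, u, c, d]

end Hypergraph3

/-! ### Counting swaps, and weighting hyperedges by inverse codegrees -/

section AbsorberCounts

open Finset

open scoped Classical

variable {V : Type*} [Fintype V] {H : Hypergraph3 V} {R : ∀ v, (H.link v).Subgraph}

/-- If few edges of `R u` are not connectable, then `u` can be swapped with any vertex in many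
ways. -/
theorem le_card_filter_isSwap {α β ζ : ℝ} (hα : 0 < α) {l : ℕ}
    (hR : ∀ v, (H.link v).IsRobustSubgraph α β l (R v)) (u v : V)
    (hu : (#{e : V × V | (R u).Adj e.1 e.2 ∧ ¬ H.IsConnectable R ζ e.1 e.2} : ℝ) ≤
      α / 2 * (Fintype.card V : ℝ) ^ 2) :
    (α / 2) ^ 3 / 32 * (Fintype.card V : ℝ) ^ 4 ≤
      (#{t : (V × V) × V × V | H.IsSwap R ζ u v t.2.1 t.1.1 t.1.2 t.2.2} : ℝ) := by
  have h1 := (hR u).le_card_filter_adj_adj hα (hR v)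
  have h2 : #{e : V × V | (R u).Adj e.1 e.2 ∧ (R v).Adj e.1 e.2} ≤
      #{e : V × V | (R u).Adj e.1 e.2 ∧ (R v).Adj e.1 e.2 ∧ H.IsConnectable R ζ e.1 e.2} +
      #{e : V × V | (R u).Adj e.1 e.2 ∧ ¬ H.IsConnectable R ζ e.1 e.2} := by
    refine le_trans (card_le_card ?_) (card_union_le _ _)
    intro e he
    simp only [mem_filter, mem_univ, true_and, mem_union] at he ⊢
    tauto
  have h2' : (#{e : V × V | (R u).Adj e.1 e.2 ∧ (R v).Adj e.1 e.2} : ℝ) ≤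
      #{e : V × V | (R u).Adj e.1 e.2 ∧ (R v).Adj e.1 e.2 ∧ H.IsConnectable R ζ e.1 e.2} +
      #{e : V × V | (R u).Adj e.1 e.2 ∧ ¬ H.IsConnectable R ζ e.1 e.2} := by exact_mod_cast h2
  -- A walk a b c d in the graph of connectable common edges makes both a b u c d and a b v c d
  -- tight, with connectable end-pairs. At most half of the αn² common pairs are lost to
  -- non-connectability.
  obtain ⟨G, hG⟩ : ∃ G : V → V → Prop, ∀ a b, G a b ↔
      (R u).Adj a b ∧ (R v).Adj a b ∧ H.IsConnectable R ζ a b := ⟨_, fun _ _ => Iff.rfl⟩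
  have h3 := le_card_filter_walk G
    (fun a b h => by
      rw [hG] at h ⊢
      exact ⟨h.1.symm, h.2.1.symm, h.2.2.symm⟩) (γ := α / 2) (by positivity) (by
        simp only [hG]
        linarith)
  refine h3.trans ?_
  rw [Nat.cast_le]
  refine card_le_card fun t ht => ?_
  simp only [mem_filter, mem_univ, true_and, hG] at ht ⊢
  obtain ⟨h1, h2, h3⟩ := ht
  have key : ∀ w, (R w).Adj t.2.1 t.1.1 → (R w).Adj t.1.1 t.1.2 → (R w).Adj t.1.2 t.2.2 →
      TightList H.Rel [t.2.1, t.1.1, w, t.1.2, t.2.2] := fun w h1 h2 h3 =>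
    ⟨(H.link_adj_rotate _ _ _ h1.adj_sub).1, (H.link_adj_rotate _ _ _ h2.adj_sub).2.1,
      h3.adj_sub, trivial⟩
  exact ⟨h1.2.2, h3.2.2, key u h1.1 h2.1 h3.1, key v h1.2.1 h2.2.1 h3.2.1⟩

theorem card_filter_triple_eq_sum (P : V → V → V → Prop) :
    #{t : V × V × V | P t.1 t.2.1 t.2.2} = ∑ x, ∑ y, #{z | P x y z} := by
  simp only [card_filter]
  rw [Fintype.sum_prod_type]
  simp only [Fintype.sum_prod_type]

/-- Atypicality and richness single out one vertex of the triple, whereas the codegree estimate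
needs all orders at once; passing between the two costs a factor 6. -/
theorem card_filter_six_orderings_le (P : V → V → V → Prop) :
    #{t : V × V × V | P t.1 t.2.1 t.2.2 ∨ P t.1 t.2.2 t.2.1 ∨ P t.2.1 t.1 t.2.2 ∨
      P t.2.1 t.2.2 t.1 ∨ P t.2.2 t.1 t.2.1 ∨ P t.2.2 t.2.1 t.1} ≤
      6 * #{t : V × V × V | P t.1 t.2.1 t.2.2} := by
  obtain ⟨S, hS⟩ : ∃ S : Finset (V × V × V), S = univ.filter fun t => P t.1 t.2.1 t.2.2 := ⟨_, rfl⟩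
  have hmem : ∀ x y z, (x, y, z) ∈ S ↔ P x y z := by simp [hS]
  rw [← hS]
  have h : (univ.filter fun t : V × V × V => P t.1 t.2.1 t.2.2 ∨ P t.1 t.2.2 t.2.1 ∨
      P t.2.1 t.1 t.2.2 ∨ P t.2.1 t.2.2 t.1 ∨ P t.2.2 t.1 t.2.1 ∨ P t.2.2 t.2.1 t.1) ⊆
      S ∪ (S.image (fun t => (t.1, t.2.2, t.2.1)) ∪ (S.image (fun t => (t.2.1, t.1, t.2.2)) ∪
      (S.image (fun t => (t.2.2, t.1, t.2.1)) ∪ (S.image (fun t => (t.2.1, t.2.2, t.1)) ∪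
      S.image (fun t => (t.2.2, t.2.1, t.1)))))) := by
    rintro ⟨x, y, z⟩ ht
    simp only [mem_filter, mem_univ, true_and, ← hmem] at ht
    simp only [mem_union, mem_image, Prod.mk.injEq]
    rcases ht with h | h | h | h | h | h
    · exact Or.inl h
    · exact Or.inr (Or.inl ⟨_, h, rfl, rfl, rfl⟩)
    · exact Or.inr (Or.inr (Or.inl ⟨_, h, rfl, rfl, rfl⟩))
    · exact Or.inr (Or.inr (Or.inr (Or.inl ⟨_, h, rfl, rfl, rfl⟩)))
    · exact Or.inr (Or.inr (Or.inr (Or.inr (Or.inl ⟨_, h, rfl, rfl, rfl⟩))))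
    · exact Or.inr (Or.inr (Or.inr (Or.inr (Or.inr ⟨_, h, rfl, rfl, rfl⟩))))
  refine (card_le_card h).trans ?_
  have hi : ∀ f : V × V × V → V × V × V, #(S.image f) ≤ #S := fun f => card_image_le
  have hu : ∀ (f : V × V × V → V × V × V) (T : Finset (V × V × V)) (k : ℕ), #T ≤ k * #S →
      #(S.image f ∪ T) ≤ (k + 1) * #S := by
    intro f T k hT
    have := card_union_le (S.image f) T
    have := hi f
    linarith
  have h5 := hu (fun t => (t.1, t.2.2, t.2.1)) _ 4 <| hu (fun t => (t.2.1, t.1, t.2.2)) _ 3 <|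
    hu (fun t => (t.2.2, t.1, t.2.1)) _ 2 <| hu (fun t => (t.2.1, t.2.2, t.1)) _ 1 <|
    (by simpa using hi (fun t => (t.2.2, t.2.1, t.1)))
  have := card_union_le S (S.image (fun t => (t.1, t.2.2, t.2.1)) ∪
      (S.image (fun t => (t.2.1, t.1, t.2.2)) ∪
      (S.image (fun t => (t.2.2, t.1, t.2.1)) ∪ (S.image (fun t => (t.2.1, t.2.2, t.1)) ∪
      S.image (fun t => (t.2.2, t.2.1, t.1))))))
  linarith

/-- The number of hyperedges containing two given vertices. -/
noncomputable def Hypergraph3.codegree (H : Hypergraph3 V) (a b : V) : ℕ := #{c | H.Rel a b c}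

theorem Hypergraph3.codegree_comm (a b : V) : H.codegree a b = H.codegree b a := by
  unfold Hypergraph3.codegree
  congr 1
  ext c
  simp only [mem_filter, mem_univ, true_and]
  exact ⟨fun h => h.swap, fun h => h.swap⟩

theorem le_card_filter_rel {d : ℝ} (hdeg : d * ((Fintype.card V : ℝ) ^ 2 / 2) ≤ H.minDegree) :
    d * (Fintype.card V : ℝ) ^ 3 ≤ (#{t : V × V × V | H.Rel t.1 t.2.1 t.2.2} : ℝ) := by
  have h1 := card_filter_prod_eq_sum fun (x : V) (e : V × V) => H.Rel x e.1 e.2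
  have h2 : ∀ x, 2 * H.minDegree ≤ #{e : V × V | H.Rel x e.1 e.2} := fun x => by
    refine le_trans ?_ (card_filter_adj (H.link x)).ge
    have := H.minDegree_le_degree x
    have := H.degree_le_ncard_edgeSet_link x
    omega
  have h3 : ∑ x : V, 2 * H.minDegree ≤ #{t : V × V × V | H.Rel t.1 t.2.1 t.2.2} := by
    rw [h1]
    exact sum_le_sum fun x _ => h2 x
  rw [sum_const, card_univ, smul_eq_mul] at h3
  have h4 : (Fintype.card V : ℝ) * (2 * H.minDegree) ≤
      #{t : V × V × V | H.Rel t.1 t.2.1 t.2.2} := by exact_mod_cast h3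
  refine le_trans ?_ h4
  have := mul_le_mul_of_nonneg_left hdeg (Nat.cast_nonneg (α := ℝ) (Fintype.card V))
  linarith

/-- An ordered pair of positive codegree d lies in d of the triples, each of weight n/d, and so
contributes n in all; pairs of codegree zero contribute nothing. -/
theorem sum_rel_div_codegree_le (H : Hypergraph3 V) :
    ∑ t : V × V × V with H.Rel t.1 t.2.1 t.2.2,
      (Fintype.card V : ℝ) / H.codegree t.1 t.2.1 ≤ (Fintype.card V : ℝ) ^ 3 := by
  rw [sum_filter, Fintype.sum_prod_type]
  simp only [Fintype.sum_prod_type]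
  calc ∑ x, ∑ y, ∑ z, (if H.Rel x y z then (Fintype.card V : ℝ) / H.codegree x y else 0)
      ≤ ∑ x : V, ∑ y : V, (Fintype.card V : ℝ) := by
        refine sum_le_sum fun x _ => sum_le_sum fun y _ => ?_
        rw [← sum_filter, sum_const, nsmul_eq_mul]
        change (H.codegree x y : ℝ) * _ ≤ _
        rcases Nat.eq_zero_or_pos (H.codegree x y) with h | h
        · simp [h]
        · have : (H.codegree x y : ℝ) ≠ 0 := by positivity
          field_simp
          rfl
    _ = _ := by
      simp only [sum_const, card_univ, nsmul_eq_mul]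
      ring

theorem sum_rel_sum_div_codegree_le (H : Hypergraph3 V) :
    ∑ t : V × V × V with H.Rel t.1 t.2.1 t.2.2,
      ((Fintype.card V : ℝ) / H.codegree t.1 t.2.1 + (Fintype.card V : ℝ) / H.codegree t.2.1 t.2.2 +
        (Fintype.card V : ℝ) / H.codegree t.2.2 t.1) ≤ 3 * (Fintype.card V : ℝ) ^ 3 := by
  have h1 := sum_rel_div_codegree_le H
  have h2 : ∑ t : V × V × V with H.Rel t.1 t.2.1 t.2.2,
      (Fintype.card V : ℝ) / H.codegree t.2.1 t.2.2 = ∑ t : V × V × V with H.Rel t.1 t.2.1 t.2.2,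
      (Fintype.card V : ℝ) / H.codegree t.1 t.2.1 := by
    refine sum_nbij' (fun t => (t.2.1, t.2.2, t.1)) (fun t => (t.2.2, t.1, t.2.1)) ?_ ?_ ?_ ?_ ?_
    · intro t ht
      simp only [mem_filter, mem_univ, true_and] at ht ⊢
      exact ht.rotate
    · intro t ht
      simp only [mem_filter, mem_univ, true_and] at ht ⊢
      exact ht.rotate.rotate
    all_goals intros; rfl
  have h3 : ∑ t : V × V × V with H.Rel t.1 t.2.1 t.2.2,
      (Fintype.card V : ℝ) / H.codegree t.2.2 t.1 = ∑ t : V × V × V with H.Rel t.1 t.2.1 t.2.2,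
      (Fintype.card V : ℝ) / H.codegree t.1 t.2.1 := by
    refine sum_nbij' (fun t => (t.2.2, t.1, t.2.1)) (fun t => (t.2.1, t.2.2, t.1)) ?_ ?_ ?_ ?_ ?_
    · intro t ht
      simp only [mem_filter, mem_univ, true_and] at ht ⊢
      exact ht.rotate.rotate
    · intro t ht
      simp only [mem_filter, mem_univ, true_and] at ht ⊢
      exact ht.rotate
    all_goals intros; rfl
  rw [sum_add_distrib, sum_add_distrib, h2, h3]
  linarith

/-- Each 1/x is bounded below by its tangent at 1/a. The minimum is near p = 1.01/(1 + √2), where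
1/p is about 2.4 and 1/q, 1/r about 1.7. These slopes give more than 5.7, well above the average
27/5 that has to be beaten. -/
theorem harmonic_sum_ge_of_add_le {p q r : ℝ} (hp : 0 < p) (hq : 0 < q) (hr : 0 < r)
    (hpq : p + q ≤ 101 / 100) (hpr : p + r ≤ 101 / 100) : 28 / 5 ≤ 1 / p + 1 / q + 1 / r := by
  have key : ∀ a x : ℝ, 0 < x → 2 * a - a ^ 2 * x ≤ 1 / x := by
    intro a x hx
    rw [le_div_iff₀ hx]
    nlinarith [sq_nonneg (a * x - 1)]
  have h1 := key 2.4 p hp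
  have h2 := key 1.7 q hq
  have h3 := key 1.7 r hr
  norm_num at h1 h2 h3
  norm_num
  linarith

end AbsorberCounts

/-! ### Typical hyperedges that are not rich have small codegrees -/

section AbsorberCounts

open Finset

open scoped Classical

variable {V : Type*} [Fintype V] {H : Hypergraph3 V} {R : ∀ v, (H.link v).Subgraph}

/-- The edge `ba` of the link of `u` leaves the vertex set of `R u`, or it is an edge of `R u`
which is not connectable. -/
def Hypergraph3.IsExceptional (H : Hypergraph3 V) (R : ∀ v, (H.link v).Subgraph) (ζ : ℝ)
    (u b a : V) : Prop :=
  (H.Rel u b a ∧ (b ∈ (R u).verts ∧ a ∉ (R u).verts)) ∨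
    (H.Rel u b a ∧ (a ∈ (R u).verts ∧ b ∉ (R u).verts)) ∨
    ((R u).Adj b a ∧ ¬ H.IsConnectable R ζ b a)

/-- The triple is exceptional or its first two vertices lie in many exceptional triples. -/
def Hypergraph3.IsAtypical (H : Hypergraph3 V) (R : ∀ v, (H.link v).Subgraph) (ζ : ℝ)
    (u b a : V) : Prop :=
  H.IsExceptional R ζ u b a ∨
    1 / 200 * (Fintype.card V : ℝ) < #{c | H.IsExceptional R ζ u b c}

/-- The hyperedge `ubc` extends in many ways to `a, b, c, d` such that `u` can be inserted in the
middle of `a b c d`. -/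
def Hypergraph3.IsRich (H : Hypergraph3 V) (R : ∀ v, (H.link v).Subgraph) (ζ : ℝ)
    (u b c : V) : Prop :=
  H.Rel u b c ∧
    1 / 200 * (Fintype.card V : ℝ) ≤
      #{a | H.Rel a b c ∧ (R u).Adj a b ∧ H.IsConnectable R ζ a b} ∧
    1 / 200 * (Fintype.card V : ℝ) ≤
      #{d | H.Rel b c d ∧ (R u).Adj c d ∧ H.IsConnectable R ζ c d}

/-- Edges leaving V(R_u), in either order, give 2 · α/4, and non-connectable edges give ζ. -/
theorem card_filter_isExceptional_le {α β ζ : ℝ} (hζ : 0 ≤ ζ) {l : ℕ}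
    (hR : ∀ v, (H.link v).IsRobustSubgraph α β l (R v)) :
    (#{t : V × V × V | H.IsExceptional R ζ t.1 t.2.1 t.2.2} : ℝ) ≤
      (α / 2 + ζ) * (Fintype.card V : ℝ) ^ 3 := by
  have h1 : ∀ u, (#{e : V × V | H.Rel u e.1 e.2 ∧ e.1 ∈ (R u).verts ∧ e.2 ∉ (R u).verts} : ℝ) ≤
      α * (Fintype.card V : ℝ) ^ 2 / 4 := by
    intro u
    have h := (hR u).card_leaving
    rw [Nat.card_eq_fintype_card] at h
    refine le_trans ?_ h
    exact_mod_cast (H.link u).card_filter_adj_between_le (R u).verts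
  have h2 : ∀ u, (#{e : V × V | H.Rel u e.1 e.2 ∧ e.2 ∈ (R u).verts ∧ e.1 ∉ (R u).verts} : ℝ) ≤
      α * (Fintype.card V : ℝ) ^ 2 / 4 := by
    intro u
    refine le_trans ?_ (h1 u)
    rw [Nat.cast_le]
    refine card_le_card_of_injOn Prod.swap ?_ Prod.swap_injective.injOn
    intro e he
    simp only [coe_filter, mem_univ, true_and, Set.mem_ofPred_eq, Prod.fst_swap,
      Prod.snd_swap] at he ⊢
    exact ⟨he.1.rotate.swap.rotate.rotate, he.2⟩
  have hsum : ∀ P : V → V × V → Prop,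
      (∀ u, (#{e | P u e} : ℝ) ≤ α * (Fintype.card V : ℝ) ^ 2 / 4) →
      (#{t : V × V × V | P t.1 t.2} : ℝ) ≤ α / 4 * (Fintype.card V : ℝ) ^ 3 := by
    intro P hP
    rw [card_filter_prod_eq_sum P]
    push_cast
    refine (sum_le_sum fun u _ => hP u).trans ?_
    rw [sum_const, card_univ, nsmul_eq_mul]
    apply le_of_eq
    ring
  have h3 := hsum (fun u e => H.Rel u e.1 e.2 ∧ e.1 ∈ (R u).verts ∧ e.2 ∉ (R u).verts)
    (fun u => by convert h1 u)
  have h4 := hsum (fun u e => H.Rel u e.1 e.2 ∧ e.2 ∈ (R u).verts ∧ e.1 ∉ (R u).verts)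
    (fun u => by convert h2 u)
  have h5 := H.card_filter_adj_not_isConnectable_le R hζ
  have h6 : #{t : V × V × V | H.IsExceptional R ζ t.1 t.2.1 t.2.2} ≤
      #{t : V × V × V | H.Rel t.1 t.2.1 t.2.2 ∧ t.2.1 ∈ (R t.1).verts ∧ t.2.2 ∉ (R t.1).verts} +
      (#{t : V × V × V | H.Rel t.1 t.2.1 t.2.2 ∧ t.2.2 ∈ (R t.1).verts ∧ t.2.1 ∉ (R t.1).verts} +
      #{t : V × V × V | (R t.1).Adj t.2.1 t.2.2 ∧ ¬ H.IsConnectable R ζ t.2.1 t.2.2}) := by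
    refine le_trans (card_le_card ?_) ((card_union_le _ _).trans
      (Nat.add_le_add_left (card_union_le _ _) _))
    intro t ht
    simp only [mem_filter, mem_univ, true_and, mem_union] at ht ⊢
    exact ht
  have h6' : (#{t : V × V × V | H.IsExceptional R ζ t.1 t.2.1 t.2.2} : ℝ) ≤
      #{t : V × V × V | H.Rel t.1 t.2.1 t.2.2 ∧ t.2.1 ∈ (R t.1).verts ∧ t.2.2 ∉ (R t.1).verts} +
      (#{t : V × V × V | H.Rel t.1 t.2.1 t.2.2 ∧ t.2.2 ∈ (R t.1).verts ∧ t.2.1 ∉ (R t.1).verts} +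
      #{t : V × V × V | (R t.1).Adj t.2.1 t.2.2 ∧ ¬ H.IsConnectable R ζ t.2.1 t.2.2}) := by
    exact_mod_cast h6
  have h3' : (#{t : V × V × V | H.Rel t.1 t.2.1 t.2.2 ∧ t.2.1 ∈ (R t.1).verts ∧
      t.2.2 ∉ (R t.1).verts} : ℝ) ≤ α / 4 * (Fintype.card V : ℝ) ^ 3 := by convert h3
  have h4' : (#{t : V × V × V | H.Rel t.1 t.2.1 t.2.2 ∧ t.2.2 ∈ (R t.1).verts ∧
      t.2.1 ∉ (R t.1).verts} : ℝ) ≤ α / 4 * (Fintype.card V : ℝ) ^ 3 := by convert h4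
  linarith

/-- By Markov's inequality, pairs (u, b) in more than n/200 exceptional triples account for at most
200 times as many triples as are exceptional; adding the exceptional ones gives 201. -/
theorem card_filter_isAtypical_le {α β ζ : ℝ} (hζ : 0 ≤ ζ) {l : ℕ}
    (hR : ∀ v, (H.link v).IsRobustSubgraph α β l (R v)) :
    (#{t : V × V × V | H.IsAtypical R ζ t.1 t.2.1 t.2.2} : ℝ) ≤
      201 * ((α / 2 + ζ) * (Fintype.card V : ℝ) ^ 3) := by
  have h1 := card_filter_isExceptional_le hζ hR
  have h2 : (#{t : V × V × V | 1 / 200 * (Fintype.card V : ℝ) <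
      #{c | H.IsExceptional R ζ t.1 t.2.1 c}} : ℝ) ≤
      200 * #{t : V × V × V | H.IsExceptional R ζ t.1 t.2.1 t.2.2} := by
    have h3 := card_filter_triple_eq_sum fun u b _ : V => 1 / 200 * (Fintype.card V : ℝ) <
      #{c | H.IsExceptional R ζ u b c}
    rw [h3, card_filter_triple_eq_sum]
    push_cast
    rw [mul_sum]
    refine sum_le_sum fun u _ => ?_
    rw [mul_sum]
    refine sum_le_sum fun b _ => ?_
    by_cases h : 1 / 200 * (Fintype.card V : ℝ) < #{c | H.IsExceptional R ζ u b c}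
    · simp only [h, filter_true, card_univ]
      linarith
    · simp only [h, filter_false, card_empty, Nat.cast_zero]
      positivity
  have h4 : #{t : V × V × V | H.IsAtypical R ζ t.1 t.2.1 t.2.2} ≤
      #{t : V × V × V | H.IsExceptional R ζ t.1 t.2.1 t.2.2} +
      #{t : V × V × V | 1 / 200 * (Fintype.card V : ℝ) <
      #{c | H.IsExceptional R ζ t.1 t.2.1 c}} := by
    refine le_trans (card_le_card ?_) (card_union_le _ _)
    intro t ht
    simp only [mem_filter, mem_univ, true_and, mem_union] at ht ⊢
    exact ht
  have h4' : (#{t : V × V × V | H.IsAtypical R ζ t.1 t.2.1 t.2.2} : ℝ) ≤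
      #{t : V × V × V | H.IsExceptional R ζ t.1 t.2.1 t.2.2} +
      #{t : V × V × V | 1 / 200 * (Fintype.card V : ℝ) <
      #{c | H.IsExceptional R ζ t.1 t.2.1 c}} := by exact_mod_cast h4
  linarith

/-- From b outside V(R_u), a link edge into V(R_u) is exceptional. So all but n/200 of the
neighbours of b in the link of u lie in the complement of V(R_u), which has at most n/3 vertices. -/
theorem codegree_le_of_not_mem_verts {α β ζ : ℝ} (hα : 0 < α) {l : ℕ}
    (hR : ∀ v, (H.link v).IsRobustSubgraph α β l (R v)) {u b c : V} (h : H.Rel u b c)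
    (ht : ¬ H.IsAtypical R ζ u b c) (hb : b ∉ (R u).verts) :
    c ∉ (R u).verts ∧ (H.codegree u b : ℝ) ≤ (1 / 3 + 1 / 200) * Fintype.card V := by
  rw [Hypergraph3.IsAtypical, not_or, not_lt] at ht
  refine ⟨fun hc => ht.1 (Or.inr (Or.inl ⟨h, hc, hb⟩)), ?_⟩
  have h1 : H.codegree u b ≤ #(univ \ (R u).verts.toFinset) +
      #{c | H.IsExceptional R ζ u b c} := by
    refine le_trans (card_le_card ?_) (card_union_le _ _)
    intro d hd
    simp only [mem_filter, mem_univ, true_and, mem_union, mem_sdiff, Set.mem_toFinset] at hd ⊢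
    by_cases hd' : d ∈ (R u).verts
    · exact Or.inr (Or.inr (Or.inl ⟨hd, hd', hb⟩))
    · exact Or.inl hd'
  have h2 : #(univ \ (R u).verts.toFinset) + (R u).verts.ncard = Fintype.card V := by
    rw [Set.ncard_eq_toFinset_card', card_sdiff_add_card_eq_card (subset_univ _), card_univ]
  have h1' : (H.codegree u b : ℝ) ≤ #(univ \ (R u).verts.toFinset) +
      #{c | H.IsExceptional R ζ u b c} := by exact_mod_cast h1
  have h2' : (#(univ \ (R u).verts.toFinset) : ℝ) + (R u).verts.ncard = Fintype.card V := by
    exact_mod_cast h2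
  have h3 := (hR u).card_verts
  rw [Nat.card_eq_fintype_card] at h3
  have : 0 ≤ α * (Fintype.card V : ℝ) := by positivity
  linarith [ht.2]

/-- This is inclusion–exclusion for the vertices completing bc to a hyperedge and the connectable
R_u-neighbours of b. As R_u is induced, the latter are all link neighbours of b except exceptional
ones, so a large sum of codegrees forces many a that can precede b, c. -/
theorem codegree_add_codegree_le {ζ : ℝ} (hR : ∀ v, (R v).IsInduced) {u b c : V}
    (ht : (#{c | H.IsExceptional R ζ u b c} : ℝ) ≤ 1 / 200 * Fintype.card V)
    (hb : b ∈ (R u).verts) :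
    (H.codegree b c : ℝ) + H.codegree u b ≤ (1 + 1 / 200) * Fintype.card V +
      #{a | H.Rel a b c ∧ (R u).Adj a b ∧ H.IsConnectable R ζ a b} := by
  have h1 : H.codegree u b ≤ #{a | (R u).Adj a b ∧ H.IsConnectable R ζ a b} +
      #{c | H.IsExceptional R ζ u b c} := by
    refine le_trans (card_le_card ?_) (card_union_le _ _)
    intro a ha
    simp only [mem_filter, mem_univ, true_and, mem_union] at ha ⊢
    by_cases haA : a ∈ (R u).verts
    · have hadj : (R u).Adj b a := hR u hb haA ha
      by_cases hc : H.IsConnectable R ζ b a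
      · exact Or.inl ⟨hadj.symm, hc.symm⟩
      · exact Or.inr (Or.inr (Or.inr ⟨hadj, hc⟩))
    · exact Or.inr (Or.inl ⟨ha, hb, haA⟩)
  have h2 := card_union_add_card_inter (univ.filter fun a => H.Rel b c a)
    (univ.filter fun a => (R u).Adj a b ∧ H.IsConnectable R ζ a b)
  have h3 := card_le_univ ((univ.filter fun a => H.Rel b c a) ∪
    (univ.filter fun a => (R u).Adj a b ∧ H.IsConnectable R ζ a b))
  have h4 : #((univ.filter fun a => H.Rel b c a) ∩
      (univ.filter fun a => (R u).Adj a b ∧ H.IsConnectable R ζ a b)) ≤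
      #{a | H.Rel a b c ∧ (R u).Adj a b ∧ H.IsConnectable R ζ a b} := by
    refine card_le_card fun a ha => ?_
    simp only [mem_filter, mem_univ, true_and, mem_inter] at ha ⊢
    exact ⟨ha.1.rotate.rotate, ha.2⟩
  have h5 : H.codegree b c + H.codegree u b ≤ Fintype.card V +
      #{a | H.Rel a b c ∧ (R u).Adj a b ∧ H.IsConnectable R ζ a b} +
      #{c | H.IsExceptional R ζ u b c} := by
    have : H.codegree b c = #(univ.filter fun a => H.Rel b c a) := rfl
    omega
  have h5' : (H.codegree b c : ℝ) + H.codegree u b ≤ Fintype.card V +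
      #{a | H.Rel a b c ∧ (R u).Adj a b ∧ H.IsConnectable R ζ a b} +
      #{c | H.IsExceptional R ζ u b c} := by exact_mod_cast h5
  linarith

theorem codegree_add_codegree_le_of_not_isRich {ζ : ℝ} (hR : ∀ v, (R v).IsInduced) {u b c : V}
    (h : H.Rel u b c) (hb : ¬ H.IsAtypical R ζ u b c) (hc : ¬ H.IsAtypical R ζ u c b)
    (hbA : b ∈ (R u).verts) (hr : ¬ H.IsRich R ζ u b c) :
    (H.codegree b c : ℝ) + H.codegree u b ≤ 101 / 100 * Fintype.card V ∨
      (H.codegree b c : ℝ) + H.codegree u c ≤ 101 / 100 * Fintype.card V := by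
  rw [Hypergraph3.IsAtypical, not_or, not_lt] at hb hc
  have hcA : c ∈ (R u).verts := by
    by_contra hcA
    exact hb.1 (Or.inl ⟨h, hbA, hcA⟩)
  rw [Hypergraph3.IsRich, not_and, not_and_or, not_le, not_le] at hr
  have h1 := codegree_add_codegree_le hR (c := c) hb.2 hbA
  have h2 := codegree_add_codegree_le hR (c := b) hc.2 hcA
  rw [H.codegree_comm c b] at h2
  have h3 : (#{a | H.Rel a c b ∧ (R u).Adj a c ∧ H.IsConnectable R ζ a c} : ℝ) =
      #{d | H.Rel b c d ∧ (R u).Adj c d ∧ H.IsConnectable R ζ c d} := by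
    congr 2
    ext d
    simp only [mem_filter, mem_univ, true_and]
    exact ⟨fun h => ⟨h.1.rotate.swap, h.2.1.symm, h.2.2.symm⟩,
      fun h => ⟨h.1.swap.rotate.rotate, h.2.1.symm, h.2.2.symm⟩⟩
  rw [h3] at h2
  rcases hr h with hr | hr
  · left
    linarith
  · right
    linarith

/-- If some vertex of the hyperedge has another one outside its robust subgraph, two of the
codegrees are at most about n/3 and the bound is immediate. Otherwise each of the three vertices, by
failing to be insertable, makes a sum of two codegrees small. -/
theorem sum_div_codegree_ge {α β ζ : ℝ} (hα : 0 < α) {l : ℕ}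
    (hR : ∀ v, (H.link v).IsRobustSubgraph α β l (R v)) {x y z : V} (h : H.Rel x y z)
    (ht : ¬ (H.IsAtypical R ζ x y z ∨ H.IsAtypical R ζ x z y ∨ H.IsAtypical R ζ y x z ∨
      H.IsAtypical R ζ y z x ∨ H.IsAtypical R ζ z x y ∨ H.IsAtypical R ζ z y x))
    (hr : ¬ (H.IsRich R ζ x y z ∨ H.IsRich R ζ x z y ∨ H.IsRich R ζ y x z ∨
      H.IsRich R ζ y z x ∨ H.IsRich R ζ z x y ∨ H.IsRich R ζ z y x)) :
    28 / 5 ≤ (Fintype.card V : ℝ) / H.codegree x y + (Fintype.card V : ℝ) / H.codegree y z +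
        (Fintype.card V : ℝ) / H.codegree z x := by
  simp only [not_or] at ht hr
  obtain ⟨t1, t2, t3, t4, t5, t6⟩ := ht
  obtain ⟨r1, r2, r3, r4, r5, r6⟩ := hr
  have hpos : ∀ {a b c : V}, H.Rel a b c → (0 : ℝ) < H.codegree a b := by
    intro a b c h
    rw [Nat.cast_pos, Hypergraph3.codegree, card_pos]
    exact ⟨c, by simpa using h⟩
  have hle : ∀ a b : V, (H.codegree a b : ℝ) ≤ Fintype.card V := fun a b => by
    exact_mod_cast card_le_univ _
  have hp := hpos h
  have hq := hpos h.rotate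
  have hrr := hpos h.rotate.rotate
  have hn : (0 : ℝ) < Fintype.card V := hp.trans_le (hle _ _)
  have hone : ∀ {a b c : V}, H.Rel a b c → 1 ≤ (Fintype.card V : ℝ) / H.codegree a b :=
    fun h => (one_le_div (hpos h)).2 (hle _ _)
  have hout : ∀ {a b c : V}, H.Rel a b c → ¬ H.IsAtypical R ζ a b c → ¬ H.IsAtypical R ζ a c b →
      b ∉ (R a).verts → 29 / 10 ≤ (Fintype.card V : ℝ) / H.codegree a b ∧
      29 / 10 ≤ (Fintype.card V : ℝ) / H.codegree c a := by
    intro a b c h h1 h2 hb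
    have h3 := codegree_le_of_not_mem_verts hα hR h h1 hb
    have h4 := codegree_le_of_not_mem_verts hα hR h.rotate.swap.rotate.rotate h2 h3.1
    rw [H.codegree_comm a c] at h4
    rw [le_div_iff₀ (hpos h), le_div_iff₀ (hpos h.rotate.rotate)]
    constructor <;> linarith [h3.2, h4.2]
  by_cases hx : y ∈ (R x).verts
  swap
  · have := hout h t1 t2 hx
    have := hone h.rotate
    linarith
  by_cases hy : z ∈ (R y).verts
  swap
  · have := hout h.rotate t4 t3 hy
    have := hone h.rotate.rotate
    linarith
  by_cases hz : x ∈ (R z).verts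
  swap
  · have := hout h.rotate.rotate t5 t6 hz
    have := hone h
    linarith
  have hI : ∀ v, (R v).IsInduced := fun v => (hR v).induced
  have d1 := codegree_add_codegree_le_of_not_isRich hI h t1 t2 hx r1
  have d2 := codegree_add_codegree_le_of_not_isRich hI h.rotate t4 t3 hy r4
  have d3 := codegree_add_codegree_le_of_not_isRich hI h.rotate.rotate t5 t6 hz r5
  rw [H.codegree_comm x z] at d1
  rw [H.codegree_comm y x] at d2
  rw [H.codegree_comm z y] at d3
  set n : ℝ := (Fintype.card V : ℝ)
  obtain ⟨p, hp'⟩ : ∃ p : ℝ, p = H.codegree x y / n := ⟨_, rfl⟩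
  obtain ⟨q, hq'⟩ : ∃ q : ℝ, q = H.codegree y z / n := ⟨_, rfl⟩
  obtain ⟨r, hr'⟩ : ∃ r : ℝ, r = H.codegree z x / n := ⟨_, rfl⟩
  have ep : (H.codegree x y : ℝ) = p * n := by rw [hp']; field_simp
  have eq : (H.codegree y z : ℝ) = q * n := by rw [hq']; field_simp
  have er : (H.codegree z x : ℝ) = r * n := by rw [hr']; field_simp
  have hp0 : 0 < p := by rw [hp']; positivity
  have hq0 : 0 < q := by rw [hq']; positivity
  have hr0 : 0 < r := by rw [hr']; positivity
  have e : ∀ s : ℝ, n / (s * n) = 1 / s := by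
    intro s
    rw [mul_comm, ← div_div, div_self hn.ne']
  simp only [ep, eq, er] at d1 d2 d3 ⊢
  rw [e, e, e]
  have hs : ∀ a b : ℝ, a * n + b * n ≤ 101 / 100 * n → a + b ≤ 101 / 100 := by
    intro a b h
    rw [← add_mul] at h
    exact le_of_mul_le_mul_right h hn
  have d1 := d1.imp (hs _ _) (hs _ _)
  have d2 := d2.imp (hs _ _) (hs _ _)
  have d3 := d3.imp (hs _ _) (hs _ _)
  have A := fun h1 h2 => harmonic_sum_ge_of_add_le hp0 hq0 hr0 h1 h2
  have B := fun h1 h2 => harmonic_sum_ge_of_add_le hq0 hp0 hr0 h1 h2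
  have C := fun h1 h2 => harmonic_sum_ge_of_add_le hr0 hp0 hq0 h1 h2
  -- Each of `d1`, `d2`, `d3` bounds one of two of the sums p + q, q + r, p + r, and each sum is
  -- omitted by exactly one of them. So two different sums are bounded; they share a term, which
  -- plays the role of p in `harmonic_sum_ge_of_add_le`.
  rcases d1 with d1 | d1
  · rcases d2 with d2 | d2
    · linarith [B (by linarith) (by linarith)]
    · linarith [A (by linarith) (by linarith)]
  · rcases d2 with d2 | d2
    · rcases d3 with d3 | d3
      · linarith [C (by linarith) (by linarith)]
      · linarith [B (by linarith) (by linarith)]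
    · linarith [C (by linarith) (by linarith)]

end AbsorberCounts

/-! ### Many rich hyperedges, hence many insertions -/

section AbsorberCounts

open Finset

open scoped Classical

variable {V : Type*} [Fintype V] {H : Hypergraph3 V} {R : ∀ v, (H.link v).Subgraph}

/-- Typical triples with no rich order have weight at least 28/5 each, so there are at most
(15/28)n³ of them, short of (5/9)n³ by (5/252)n³. Atypical orders use up at most 6 · 201/200000 of
this gap, and a sixth of the remainder still exceeds 1/600. -/
theorem le_card_filter_isRich {α β ζ : ℝ} (hα : 0 < α) (hα' : α ≤ 1 / 200000) (hζ : 0 ≤ ζ)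
    (hζ' : ζ ≤ 1 / 400000) {l : ℕ}
    (hdeg : (5 / 9 + α) * ((Fintype.card V : ℝ) ^ 2 / 2) ≤ H.minDegree)
    (hR : ∀ v, (H.link v).IsRobustSubgraph α β l (R v)) :
    1 / 600 * (Fintype.card V : ℝ) ^ 3 ≤
      (#{t : V × V × V | H.IsRich R ζ t.1 t.2.1 t.2.2} : ℝ) := by
  have hn : (0 : ℝ) ≤ (Fintype.card V : ℝ) ^ 3 := by positivity
  have h1 := le_card_filter_rel hdeg
  have h2 := sum_rel_sum_div_codegree_le H
  have h3 := card_filter_isAtypical_le hζ hR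
  obtain ⟨T, hT⟩ : ∃ T : V × V × V → Prop, ∀ t, T t ↔ H.IsAtypical R ζ t.1 t.2.1 t.2.2 ∨
      H.IsAtypical R ζ t.1 t.2.2 t.2.1 ∨ H.IsAtypical R ζ t.2.1 t.1 t.2.2 ∨
      H.IsAtypical R ζ t.2.1 t.2.2 t.1 ∨ H.IsAtypical R ζ t.2.2 t.1 t.2.1 ∨
      H.IsAtypical R ζ t.2.2 t.2.1 t.1 := ⟨_, fun _ => Iff.rfl⟩
  obtain ⟨G, hG⟩ : ∃ G : V × V × V → Prop, ∀ t, G t ↔ H.IsRich R ζ t.1 t.2.1 t.2.2 ∨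
      H.IsRich R ζ t.1 t.2.2 t.2.1 ∨ H.IsRich R ζ t.2.1 t.1 t.2.2 ∨
      H.IsRich R ζ t.2.1 t.2.2 t.1 ∨ H.IsRich R ζ t.2.2 t.1 t.2.1 ∨
      H.IsRich R ζ t.2.2 t.2.1 t.1 := ⟨_, fun _ => Iff.rfl⟩
  have h4 : #{t | T t} ≤ 6 * #{t : V × V × V | H.IsAtypical R ζ t.1 t.2.1 t.2.2} := by
    simp only [hT]
    exact card_filter_six_orderings_le (H.IsAtypical R ζ)
  have h5 : #{t | G t} ≤ 6 * #{t : V × V × V | H.IsRich R ζ t.1 t.2.1 t.2.2} := by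
    simp only [hG]
    exact card_filter_six_orderings_le (H.IsRich R ζ)
  have h4' : (#{t | T t} : ℝ) ≤ 6 * #{t : V × V × V | H.IsAtypical R ζ t.1 t.2.1 t.2.2} := by
    exact_mod_cast h4
  have h5' : (#{t | G t} : ℝ) ≤ 6 * #{t : V × V × V | H.IsRich R ζ t.1 t.2.1 t.2.2} := by
    exact_mod_cast h5
  have h6 : #{t : V × V × V | H.Rel t.1 t.2.1 t.2.2} ≤
      #{t : V × V × V | H.Rel t.1 t.2.1 t.2.2 ∧ ¬ T t ∧ ¬ G t} + (#{t | T t} + #{t | G t}) := by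
    refine le_trans (card_le_card ?_) ((card_union_le _ _).trans
      (Nat.add_le_add_left (card_union_le _ _) _))
    intro t ht
    simp only [mem_filter, mem_univ, true_and, mem_union] at ht ⊢
    tauto
  have h6' : (#{t : V × V × V | H.Rel t.1 t.2.1 t.2.2} : ℝ) ≤
      #{t : V × V × V | H.Rel t.1 t.2.1 t.2.2 ∧ ¬ T t ∧ ¬ G t} + (#{t | T t} + #{t | G t}) := by
    exact_mod_cast h6
  have h7 : 28 / 5 * (#{t : V × V × V | H.Rel t.1 t.2.1 t.2.2 ∧ ¬ T t ∧ ¬ G t} : ℝ) ≤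
      3 * (Fintype.card V : ℝ) ^ 3 := by
    refine le_trans ?_ h2
    rw [mul_comm, ← nsmul_eq_mul, ← sum_const]
    refine le_trans (sum_le_sum fun t ht => ?_) (sum_le_sum_of_subset_of_nonneg ?_ ?_)
    · obtain ⟨ht1, ht2, ht3⟩ := (mem_filter.1 ht).2
      rw [hT] at ht2
      rw [hG] at ht3
      exact sum_div_codegree_ge hα hR ht1 ht2 ht3
    · intro t ht
      exact mem_filter.2 ⟨mem_univ _, (mem_filter.1 ht).2.1⟩
    · intros
      positivity
  have h8 : (α / 2 + ζ) * (Fintype.card V : ℝ) ^ 3 ≤ 1 / 200000 * (Fintype.card V : ℝ) ^ 3 :=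
    mul_le_mul_of_nonneg_right (by linarith) hn
  have h9 : 5 / 9 * (Fintype.card V : ℝ) ^ 3 ≤ (5 / 9 + α) * (Fintype.card V : ℝ) ^ 3 :=
    mul_le_mul_of_nonneg_right (by linarith) hn
  linarith

theorem le_card_filter_isInsert {α β ζ : ℝ} (hα : 0 < α) (hα' : α ≤ 1 / 200000) (hζ : 0 ≤ ζ)
    (hζ' : ζ ≤ 1 / 400000) {l : ℕ}
    (hdeg : (5 / 9 + α) * ((Fintype.card V : ℝ) ^ 2 / 2) ≤ H.minDegree)
    (hR : ∀ v, (H.link v).IsRobustSubgraph α β l (R v)) :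
    1 / 24000000 * (Fintype.card V : ℝ) ^ 5 ≤
      (#{t : (V × V × V) × V × V |
        H.IsInsert R ζ t.1.1 t.2.1 t.1.2.1 t.1.2.2 t.2.2} : ℝ) := by
  have h1 := le_card_filter_isRich hα hα' hζ hζ' hdeg hR
  obtain ⟨D, hD⟩ : ∃ D : Finset (V × V × V), D = univ.filter fun t =>
    H.IsRich R ζ t.1 t.2.1 t.2.2 := ⟨_, rfl⟩
  rw [← hD] at h1
  have hmem : ∀ t, t ∈ D ↔ H.IsRich R ζ t.1 t.2.1 t.2.2 := by simp [hD]
  have h2 := card_mul_mul_le_card_filter D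
    (fun t a => H.Rel a t.2.1 t.2.2 ∧ (R t.1).Adj a t.2.1 ∧ H.IsConnectable R ζ a t.2.1)
    (fun t d => H.Rel t.2.1 t.2.2 d ∧ (R t.1).Adj t.2.2 d ∧ H.IsConnectable R ζ t.2.2 d)
    (by positivity : 0 ≤ 1 / 200 * (Fintype.card V : ℝ))
    (by positivity : 0 ≤ 1 / 200 * (Fintype.card V : ℝ))
    (fun t ht => by
      have := ((hmem t).1 ht).2.1
      convert this)
    (fun t ht => by
      have := ((hmem t).1 ht).2.2
      convert this)
  calc 1 / 24000000 * (Fintype.card V : ℝ) ^ 5 = 1 / 600 * (Fintype.card V : ℝ) ^ 3 *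
        (1 / 200 * (Fintype.card V : ℝ)) * (1 / 200 * (Fintype.card V : ℝ)) := by ring
    _ ≤ #D * (1 / 200 * (Fintype.card V : ℝ)) * (1 / 200 * (Fintype.card V : ℝ)) := by gcongr
    _ ≤ _ := h2
    _ ≤ _ := by
      rw [Nat.cast_le]
      refine card_le_card fun t ht => ?_
      simp only [mem_filter, mem_univ, true_and, hmem] at ht ⊢
      obtain ⟨h, ha, hd⟩ := ht
      exact ⟨ha.2.2, hd.2.2, ⟨ha.1, hd.1, trivial⟩,
        (H.link_adj_rotate _ _ _ ha.2.1.adj_sub).1, h.1.swap,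
        hd.2.1.adj_sub, trivial⟩

end AbsorberCounts

/-! ### Absorbers for every vertex, and the weight argument -/

section Absorbers

open Finset

open scoped Classical

/-- The vertices `t 0, …, t 8` form the tight paths `t 0 … t 4` and `t 5 … t 8` with connectable
end-pairs, and `t 2` can be inserted in the middle of the second one. -/
def Hypergraph3.IsAbsorber {V : Type*} (H : Hypergraph3 V) (R : ∀ v, (H.link v).Subgraph) (ζ : ℝ)
    (t : Fin 9 → V) : Prop :=
  H.IsConnectable R ζ (t 0) (t 1) ∧ H.IsConnectable R ζ (t 3) (t 4) ∧
    TightList H.Rel [t 0, t 1, t 2, t 3, t 4] ∧ H.IsInsert R ζ (t 2) (t 5) (t 6) (t 7) (t 8)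

/-- The vertices which can replace `t 2` in the path `t 0 … t 4`. -/
def Hypergraph3.absorbed {V : Type*} (H : Hypergraph3 V) (t : Fin 9 → V) : Set V :=
  {v | TightList H.Rel [t 0, t 1, v, t 3, t 4]}

variable {V : Type*} [Fintype V] {H : Hypergraph3 V} {R : ∀ v, (H.link v).Subgraph}

/-- Vertices u with more than (α/2)n² non-connectable ordered edges cannot be swapped freely, but
there are at most 2ζn/α ≤ n/50000000 of them. Removing them from the n⁵/24000000 insertions leaves
n⁵/50000000, and every remaining u has many swaps with the given v. -/
theorem le_card_filter_isAbsorber {α β ζ : ℝ} (hα : 0 < α) (hα' : α ≤ 1 / 200000) (hζ : 0 ≤ ζ)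
    (hζ' : ζ ≤ α / 100000000) {l : ℕ}
    (hdeg : (5 / 9 + α) * ((Fintype.card V : ℝ) ^ 2 / 2) ≤ H.minDegree)
    (hR : ∀ v, (H.link v).IsRobustSubgraph α β l (R v)) (v : V) :
    1 / 50000000 * ((α / 2) ^ 3 / 32) * (Fintype.card V : ℝ) ^ 9 ≤
      (#{t | H.IsAbsorber R ζ t ∧ v ∈ H.absorbed t} : ℝ) := by
  have h1 := le_card_filter_isInsert hα hα' hζ (by linarith) hdeg hR
  set n : ℝ := (Fintype.card V : ℝ) with hn
  have hn0 : 0 ≤ n := Nat.cast_nonneg _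
  obtain ⟨U, hU⟩ : ∃ U : Finset V, ∀ u, u ∈ U ↔ α / 2 * n ^ 2 <
      #{e : V × V | (R u).Adj e.1 e.2 ∧ ¬ H.IsConnectable R ζ e.1 e.2} :=
    ⟨univ.filter fun u => α / 2 * n ^ 2 <
      #{e : V × V | (R u).Adj e.1 e.2 ∧ ¬ H.IsConnectable R ζ e.1 e.2}, by simp⟩
  have hUcard : #U * (α / 2 * n ^ 2) ≤ ζ * n ^ 3 := by
    refine le_trans ?_ (H.card_filter_adj_not_isConnectable_le R hζ)
    rw [card_filter_prod_eq_sum fun (u : V) (e : V × V) =>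
      (R u).Adj e.1 e.2 ∧ ¬ H.IsConnectable R ζ e.1 e.2]
    push_cast
    rw [← nsmul_eq_mul, ← sum_const]
    refine le_trans (sum_le_sum fun u hu => ((hU u).1 hu).le)
      (sum_le_sum_of_subset_of_nonneg (subset_univ _) fun _ _ _ => Nat.cast_nonneg _)
  have hUcard' : #U * n ^ 4 ≤ 1 / 50000000 * n ^ 5 := by
    have h2 : (#U * (α / 2 * n ^ 2)) * n ^ 2 ≤ (α / 100000000 * n ^ 3) * n ^ 2 := by
      refine mul_le_mul_of_nonneg_right (hUcard.trans ?_) (by positivity)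
      gcongr
    have h3 : α * (#U * n ^ 4) ≤ α * (1 / 50000000 * n ^ 5) := by linarith
    exact le_of_mul_le_mul_left h3 hα
  obtain ⟨D, hD⟩ : ∃ D : Finset ((V × V × V) × V × V), ∀ t, t ∈ D ↔
      H.IsInsert R ζ t.1.1 t.2.1 t.1.2.1 t.1.2.2 t.2.2 ∧ t.1.1 ∉ U :=
    ⟨univ.filter fun t => H.IsInsert R ζ t.1.1 t.2.1 t.1.2.1 t.1.2.2 t.2.2 ∧ t.1.1 ∉ U, by simp⟩
  have hDcard : 1 / 50000000 * n ^ 5 ≤ #D := by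
    have h2 : (univ.filter fun t : (V × V × V) × V × V =>
        H.IsInsert R ζ t.1.1 t.2.1 t.1.2.1 t.1.2.2 t.2.2) ⊆ D ∪ (U ×ˢ univ) ×ˢ univ := by
      intro t ht
      simp only [mem_filter, mem_univ, true_and, mem_union, hD, mem_product, and_true] at ht ⊢
      tauto
    have h3 := (card_le_card h2).trans (card_union_le _ _)
    simp only [card_product, card_univ, Fintype.card_prod] at h3
    have h4 : (#{t : (V × V × V) × V × V |
        H.IsInsert R ζ t.1.1 t.2.1 t.1.2.1 t.1.2.2 t.2.2} : ℝ) ≤ #D + #U * (n * n) * (n * n) := by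
      rw [hn]
      exact_mod_cast h3
    have h5 : 0 ≤ n ^ 5 := by positivity
    linarith
  have h2 : #(D.sigma fun s => univ.filter fun r : (V × V) × V × V =>
      H.IsSwap R ζ s.1.1 v r.2.1 r.1.1 r.1.2 r.2.2) ≤
      #{t | H.IsAbsorber R ζ t ∧ v ∈ H.absorbed t} := by
    refine card_le_card_of_injOn (fun s => ![s.2.2.1, s.2.1.1, s.1.1.1, s.2.1.2, s.2.2.2,
      s.1.2.1, s.1.1.2.1, s.1.1.2.2, s.1.2.2]) ?_ ?_
    · rintro ⟨s, r⟩ h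
      simp only [coe_sigma, Set.mem_sigma_iff, mem_coe, hD, mem_filter, mem_univ, true_and] at h
      rw [mem_coe, mem_filter]
      exact ⟨mem_univ _, ⟨h.2.1, h.2.2.1, h.2.2.2.1, h.1.1⟩, h.2.2.2.2⟩
    · rintro ⟨⟨⟨u, b, c⟩, a, d⟩, ⟨⟨b', c'⟩, a', d'⟩⟩ - ⟨⟨⟨u₁, b₁, c₁⟩, a₁, d₁⟩, ⟨⟨b₁', c₁'⟩, a₁', d₁'⟩⟩ - h
      simp only [Matrix.vecCons_inj, and_true] at h
      obtain ⟨rfl, rfl, rfl, rfl, rfl, rfl, rfl, rfl, rfl, -⟩ := h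
      rfl
  rw [card_sigma] at h2
  calc 1 / 50000000 * ((α / 2) ^ 3 / 32) * n ^ 9
      = 1 / 50000000 * n ^ 5 * ((α / 2) ^ 3 / 32 * n ^ 4) := by ring
    _ ≤ #D * ((α / 2) ^ 3 / 32 * n ^ 4) := by gcongr
    _ = ∑ s ∈ D, (α / 2) ^ 3 / 32 * n ^ 4 := by rw [sum_const, nsmul_eq_mul]
    _ ≤ ∑ s ∈ D, (#{r : (V × V) × V × V |
          H.IsSwap R ζ s.1.1 v r.2.1 r.1.1 r.1.2 r.2.2} : ℝ) :=
        sum_le_sum fun s hs => le_card_filter_isSwap hα hR _ _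
          (not_lt.1 fun h => ((hD s).1 hs).2 ((hU _).2 h))
    _ ≤ _ := by exact_mod_cast h2

/-- Average over t in D: each v is halved by at least a 2κ proportion of D, so its expected weight
drops by at least a factor 1 - κ. -/
theorem exists_sum_mul_ite_le {T : Type*} (D : Finset T) (hD : D.Nonempty) (S : T → Set V)
    (w : V → ℝ) (hw : ∀ v, 0 ≤ w v) {κ : ℝ}
    (h : ∀ v, 2 * κ * #D ≤ (#{t ∈ D | v ∈ S t} : ℝ)) :
    ∃ t ∈ D, ∑ v, w v * (if v ∈ S t then 1 / 2 else 1) ≤ (1 - κ) * ∑ v, w v := by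
  by_contra! hc
  have h1 := sum_lt_sum_of_nonempty hD hc
  rw [sum_comm, sum_const, nsmul_eq_mul] at h1
  have h2 : ∑ v, ∑ t ∈ D, w v * (if v ∈ S t then 1 / 2 else 1) ≤
      ∑ v, w v * ((1 - κ) * #D) := by
    refine sum_le_sum fun v _ => ?_
    rw [← mul_sum]
    refine mul_le_mul_of_nonneg_left ?_ (hw v)
    have h3 : ∀ t, (if v ∈ S t then (1 / 2 : ℝ) else 1) = 1 - 1 / 2 * (if v ∈ S t then 1 else 0) := by
      intro t
      split_ifs <;> norm_num
    simp only [h3]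
    rw [sum_sub_distrib, ← mul_sum, sum_boole, sum_const, nsmul_eq_mul, mul_one]
    linarith [h v]
  rw [← sum_mul] at h2
  linarith

/-- The total weight of the vertices, each being halved by every set in `A` that contains it. -/
noncomputable def potential (A : List (Set V)) : ℝ :=
  ∑ v, (1 / 2 : ℝ) ^ A.countP (fun S => decide (v ∈ S))

theorem potential_cons (S : Set V) (A : List (Set V)) : potential (S :: A) =
    ∑ v, (1 / 2 : ℝ) ^ A.countP (fun S => decide (v ∈ S)) * (if v ∈ S then 1 / 2 else 1) := by
  refine sum_congr rfl fun v _ => ?_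
  rw [List.countP_cons]
  by_cases h : v ∈ S
  · simp [h, pow_succ]
  · simp [h]

/-- If every vertex is absorbed by many absorbers, then there is one that avoids a given small set
and decreases the potential. -/
theorem exists_isAbsorber_potential_le [Nonempty V] {ζ c : ℝ} (hc : 0 < c)
    (h : ∀ v, c * (Fintype.card V : ℝ) ^ 9 ≤
      (#{t | H.IsAbsorber R ζ t ∧ v ∈ H.absorbed t} : ℝ))
    (A : List (Set V)) (F : Finset V) (hF : (#F : ℝ) + 9 ≤ c / 18 * Fintype.card V) :
    ∃ t, H.IsAbsorber R ζ t ∧ Function.Injective t ∧ (∀ i, t i ∉ F) ∧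
      potential (H.absorbed t :: A) ≤ (1 - c / 4) * potential A := by
  have hn : (0 : ℝ) < Fintype.card V := by exact_mod_cast Fintype.card_pos
  obtain ⟨D, hD⟩ : ∃ D : Finset (Fin 9 → V), ∀ t, t ∈ D ↔
      H.IsAbsorber R ζ t ∧ Function.Injective t ∧ ∀ i, t i ∉ F :=
    ⟨univ.filter fun t => H.IsAbsorber R ζ t ∧ Function.Injective t ∧ ∀ i, t i ∉ F, by simp⟩
  -- At most 9(#F + 9)n⁸ tuples repeat a vertex or meet F, which by `hF` is at most half of the
  -- absorbers of v.
  have h1 : ∀ v, c / 2 * (Fintype.card V : ℝ) ^ 9 ≤ (#{t ∈ D | v ∈ H.absorbed t} : ℝ) := by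
    intro v
    have h2 := card_filter_not_injective_or_meets_le 9 F
    have h3 : #{t | H.IsAbsorber R ζ t ∧ v ∈ H.absorbed t} ≤ #{t ∈ D | v ∈ H.absorbed t} +
        #{t : Fin 9 → V | ¬ (Function.Injective t ∧ ∀ i, t i ∉ F)} := by
      refine le_trans (card_le_card ?_) (card_union_le _ _)
      intro t ht
      simp only [mem_filter, mem_univ, true_and, mem_union, hD] at ht ⊢
      tauto
    have h3' : (#{t | H.IsAbsorber R ζ t ∧ v ∈ H.absorbed t} : ℝ) ≤ #{t ∈ D | v ∈ H.absorbed t} +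
        #{t : Fin 9 → V | ¬ (Function.Injective t ∧ ∀ i, t i ∉ F)} := by exact_mod_cast h3
    have h4 : ((9 : ℕ) : ℝ) * (#F + (9 : ℕ)) * (Fintype.card V : ℝ) ^ (9 - 1) ≤
        c / 2 * (Fintype.card V : ℝ) ^ 9 := by
      calc ((9 : ℕ) : ℝ) * (#F + (9 : ℕ)) * (Fintype.card V : ℝ) ^ (9 - 1)
          ≤ (9 * (c / 18 * Fintype.card V)) * (Fintype.card V : ℝ) ^ 8 := by
            norm_num
            gcongr
        _ = _ := by ring
    linarith [h v, h2.trans h4]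
  have hDne : D.Nonempty := by
    obtain ⟨v⟩ := ‹Nonempty V›
    have h2 : (0 : ℝ) < #{t ∈ D | v ∈ H.absorbed t} := lt_of_lt_of_le (by positivity) (h1 v)
    obtain ⟨t, ht⟩ := card_pos.1 (by exact_mod_cast h2)
    exact ⟨t, (mem_filter.1 ht).1⟩
  have hDcard : (#D : ℝ) ≤ (Fintype.card V : ℝ) ^ 9 := by
    have := card_le_univ D
    rw [Fintype.card_fun, Fintype.card_fin] at this
    exact_mod_cast this
  obtain ⟨t, ht, hp⟩ := exists_sum_mul_ite_le D hDne H.absorbed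
    (fun v => (1 / 2 : ℝ) ^ A.countP (fun S => decide (v ∈ S))) (fun v => by positivity)
    (κ := c / 4) (fun v => by
      refine le_trans ?_ (h1 v)
      have := mul_le_mul_of_nonneg_left hDcard (by positivity : 0 ≤ c / 2)
      linarith)
  rw [← potential_cons] at hp
  obtain ⟨h2, h3, h4⟩ := (hD t).1 ht
  exact ⟨t, h2, h3, h4, hp⟩

end Absorbers

/-! ### Building the path and choosing the constants -/

section AbsorbingPath

open Finset

open scoped Classical

universe u

/-- Each step adds an absorber of 9 vertices and two connectors of 6m + 4, which makes 12m + 17. The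
initial 2 is a connectable pair outside S, taken from an arbitrary absorber. -/
theorem exists_isAbsorbing (α β ζ c : ℝ) (hα : 0 < α) (hβ : 0 < β) (hζ : 0 < ζ) (hc : 0 < c)
    (m : ℕ) :
    ∃ ε : ℝ, 0 < ε ∧ ∃ n₀ : ℕ, ∀ (V : Type u) [Fintype V] [Nonempty V], n₀ ≤ Fintype.card V →
      ∀ (H : Hypergraph3 V) (R : ∀ v, (H.link v).Subgraph),
      (∀ v, (H.link v).IsRobustSubgraph α β (2 * m + 1) (R v)) →
      (∀ v, c * (Fintype.card V : ℝ) ^ 9 ≤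
        (#{t | H.IsAbsorber R ζ t ∧ v ∈ H.absorbed t} : ℝ)) →
      ∀ (S : Finset V) (i : ℕ), ((9 + i * (12 * m + 17) + #S : ℕ) : ℝ) ≤ ε * Fintype.card V →
      ∃ (x y z w : V) (P : List V) (A : List (Set V)), H.IsConnectable R ζ x y ∧
        H.IsConnectable R ζ z w ∧ IsAbsorbing H.Rel x y z w P A ∧ P.Nodup ∧ (∀ v ∈ P, v ∉ S) ∧
        z ∈ P ∧ w ∈ P ∧ P.length = 2 + i * (12 * m + 17) ∧
        potential A ≤ (1 - c / 4) ^ i * Fintype.card V := by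
  obtain ⟨ε, hε, n₀, hn₀⟩ := exists_connection.{u} α β ζ hα hβ hζ m
  refine ⟨min ε (c / 18), by positivity, n₀, ?_⟩
  intro V _ _ hn H R hR hcount S i
  have hconn := hn₀ V hn H R hR
  set n : ℝ := (Fintype.card V : ℝ) with hn'
  have hnpos : 0 < n := by
    rw [hn']
    exact_mod_cast Fintype.card_pos
  have hmin1 : min ε (c / 18) * n ≤ ε * n :=
    mul_le_mul_of_nonneg_right (min_le_left _ _) hnpos.le
  have hmin2 : min ε (c / 18) * n ≤ c / 18 * n :=
    mul_le_mul_of_nonneg_right (min_le_right _ _) hnpos.le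
  induction i with
  | zero =>
    intro hi
    obtain ⟨t, ht, htinj, htS, -⟩ := exists_isAbsorber_potential_le hc hcount [] S (by
      push_cast at hi
      linarith)
    refine ⟨t 0, t 1, t 0, t 1, [t 0, t 1], [], ht.1, ht.1, isAbsorbing_pair _ _ _, ?_, ?_, by simp,
      by simp, by simp, ?_⟩
    · simp [htinj.eq_iff]
    · simp [htS]
    · simp [potential, hn']
  | succ i ih =>
    intro hi
    obtain ⟨x, y, z, w, P, A, hxy, hzw, hPA, hP, hPS, hz, hw, hPl, hpot⟩ := ih (by
      refine le_trans ?_ hi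
      rw [Nat.cast_le]
      have : i * (12 * m + 17) ≤ (i + 1) * (12 * m + 17) := Nat.mul_le_mul_right _ (Nat.le_succ i)
      omega)
    have hcard1 : #(S ∪ P.toFinset) ≤ #S + (2 + i * (12 * m + 17)) := by
      refine (card_union_le _ _).trans ?_
      have := List.toFinset_card_le P
      omega
    have hle : #S + (2 + i * (12 * m + 17)) + (12 * m + 17) ≤
        9 + (i + 1) * (12 * m + 17) + #S := by
      rw [add_mul, one_mul]
      omega
    have hcast : ∀ k : ℕ, k ≤ 9 + (i + 1) * (12 * m + 17) + #S → (k : ℝ) ≤ min ε (c / 18) * n :=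
      fun k hk => le_trans (by exact_mod_cast hk) hi
    obtain ⟨t, ht, htinj, htS, hpot'⟩ := exists_isAbsorber_potential_le hc hcount A
      (S ∪ P.toFinset) (by
        have := hcast (#(S ∪ P.toFinset) + 9) (by omega)
        push_cast at this
        linarith)
    obtain ⟨ht1, ht2, ht3, ht4, ht5, ht6, ht7⟩ := ht
    have hcard2 : #(S ∪ P.toFinset ∪ univ.image t) ≤ #S + (2 + i * (12 * m + 17)) + 9 := by
      refine (card_union_le _ _).trans ?_
      have := card_image_le (s := univ) (f := t)
      rw [card_univ, Fintype.card_fin] at this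
      omega
    obtain ⟨M, hMl, hM, hMF, hMT⟩ := hconn z w (t 0) (t 1) hzw ht1 (S ∪ P.toFinset ∪ univ.image t)
      (by simp [hz]) (by simp [hw]) (by simp) (by simp)
      ((hcast _ (by omega)).trans hmin1)
    obtain ⟨N, hNl, hN, hNF, hNT⟩ := hconn (t 3) (t 4) (t 5) (t 6) ht2 ht4
      (S ∪ P.toFinset ∪ univ.image t ∪ M.toFinset)
      (by simp) (by simp) (by simp) (by simp)
      ((hcast _ (by
        have := card_union_le (S ∪ P.toFinset ∪ univ.image t) M.toFinset
        have := List.toFinset_card_le M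
        omega)).trans hmin1)
    simp only [mem_union, List.mem_toFinset, mem_image, mem_univ, true_and, not_or,
      not_exists] at htS hMF hNF
    have hperm : (P ++ M ++ [t 0, t 1, t 2, t 3, t 4] ++ N ++ [t 5, t 6, t 7, t 8]).Perm
        (P ++ (M ++ (N ++ List.ofFn t))) := by
      rw [List.perm_iff_count]
      intro a
      simp only [List.count_append, List.ofFn_succ, List.count_cons, List.count_nil,
        List.ofFn_zero]
      simp only [Fin.succ_zero_eq_one, Fin.succ_one_eq_two, Fin.isValue]
      change _ = _ + (_ + (_ + (((((((((0 + if t 8 == a then 1 else 0) +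
        if t 7 == a then 1 else 0) + if t 6 == a then 1 else 0) + if t 5 == a then 1 else 0) +
        if t 4 == a then 1 else 0) + if t 3 == a then 1 else 0) + _) + _) + _)))
      omega
    refine ⟨x, y, t 7, t 8, _, _, hxy, ht5, hPA.append hMT hNT ht3 ht6 ht7, ?_, ?_, by simp, by simp,
      ?_, ?_⟩
    · rw [hperm.nodup_iff, List.nodup_append', List.nodup_append', List.nodup_append']
      simp only [List.disjoint_left, List.mem_append, List.mem_ofFn, not_or, not_exists]
      refine ⟨hP, ⟨hM, ⟨hN, List.nodup_ofFn.2 htinj, ?_⟩, ?_⟩, ?_⟩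
      · intro a ha
        exact (hNF a ha).1.2
      · intro a ha
        exact ⟨fun h => (hNF a h).2 ha, (hMF a ha).2⟩
      · intro a ha
        refine ⟨fun h => (hMF a h).1.2 ha, fun h => (hNF a h).1.1.2 ha, ?_⟩
        rintro i rfl
        exact (htS i).2 ha
    · intro v hv
      rw [hperm.mem_iff] at hv
      simp only [List.mem_append, List.mem_ofFn] at hv
      rcases hv with h | h | h | ⟨i, rfl⟩
      · exact hPS v h
      · exact (hMF v h).1.1
      · exact (hNF v h).1.1.1
      · exact (htS i).1
    · rw [hperm.length_eq]
      simp [hPl, hMl, hNl]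
      ring
    · refine hpot'.trans ?_
      by_cases hc4 : c / 4 ≤ 1
      · rw [pow_succ', mul_assoc]
        exact mul_le_mul_of_nonneg_left hpot (by linarith)
      · exfalso
        obtain ⟨v⟩ := ‹Nonempty V›
        have h1 := hcount v
        have h2 : #{t | H.IsAbsorber R ζ t ∧ v ∈ H.absorbed t} ≤ Fintype.card V ^ 9 := by
          refine (card_le_univ _).trans ?_
          simp
        have h2' : (#{t | H.IsAbsorber R ζ t ∧ v ∈ H.absorbed t} : ℝ) ≤ n ^ 9 := by
          rw [hn']
          exact_mod_cast h2
        have h3 : c * n ^ 9 ≤ 1 * n ^ 9 := by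
          rw [one_mul]
          exact h1.trans h2'
        have h4 := le_of_mul_le_mul_right h3 (by positivity)
        linarith

/-- Take i about θn/C, the most that the length allows. Taking logarithms, and using log 2 ≤ 1,
gives k ≥ κi - log n. For large n this is at least κθn/(2C), and so at least 2θ²n as θ ≤ κ/(4C). -/
theorem exists_number_of_absorbers {κ θ : ℝ} {C : ℕ} (hκ : 0 < κ) (hκ1 : κ ≤ 1) (hC : 1 ≤ C)
    (hθ : 0 < θ) (hθκ : θ ≤ κ / (4 * C)) :
    ∃ n₀ : ℕ, ∀ n : ℕ, n₀ ≤ n → ∃ i : ℕ, 2 + i * C ≤ θ * n ∧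
      ∀ k : ℕ, (1 / 2 : ℝ) ^ k ≤ (1 - κ) ^ i * n → 2 * θ ^ 2 * n ≤ k := by
  have hC0 : (1 : ℝ) ≤ C := by exact_mod_cast hC
  have hlog : ∀ᶠ n : ℕ in Filter.atTop, Real.log n ≤ κ * θ / (4 * C) * n := by
    have h := (Real.isLittleO_log_id_atTop.comp_tendsto tendsto_natCast_atTop_atTop).def
      (by positivity : 0 < κ * θ / (4 * C))
    filter_upwards [h] with n hn
    simp only [Function.comp, id, Real.norm_eq_abs, Nat.abs_cast] at hn
    exact (le_abs_self _).trans hn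
  obtain ⟨n₁, hn₁⟩ := Filter.eventually_atTop.1 hlog
  obtain ⟨n₂, hn₂⟩ := exists_nat_gt (12 * C / (κ * θ))
  refine ⟨max n₁ n₂, fun n hn => ?_⟩
  have h1 := hn₁ n ((le_max_left _ _).trans hn)
  have hnn : (n₂ : ℝ) ≤ n := by exact_mod_cast (le_max_right _ _).trans hn
  have h2 : 12 * C ≤ κ * θ * n := by
    rw [div_lt_iff₀ (by positivity)] at hn₂
    have := mul_le_mul_of_nonneg_left hnn (by positivity : 0 ≤ κ * θ)
    linarith
  have h2' : 12 * C ≤ θ * n := by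
    refine h2.trans ?_
    rw [mul_assoc]
    exact mul_le_of_le_one_left (by positivity) hκ1
  have hn0 : (0 : ℝ) < n := by
    by_contra h
    have : (n : ℝ) = 0 := le_antisymm (not_lt.1 h) (Nat.cast_nonneg _)
    rw [this] at h2'
    linarith
  have hfl := Nat.floor_le (by apply div_nonneg <;> linarith : 0 ≤ (θ * n - 2) / C)
  have hfl' := Nat.lt_floor_add_one ((θ * n - 2) / C)
  refine ⟨⌊(θ * n - 2) / C⌋₊, ?_, ?_⟩
  · rw [le_div_iff₀ (by linarith)] at hfl
    linarith
  · intro k hk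
    set i := ⌊(θ * n - 2) / C⌋₊
    have h3 : Real.log ((1 / 2 : ℝ) ^ k) ≤ Real.log (Real.exp (-κ) ^ i * n) := by
      apply Real.log_le_log (by positivity)
      refine hk.trans ?_
      refine mul_le_mul_of_nonneg_right ?_ hn0.le
      exact pow_le_pow_left₀ (by linarith) (by linarith [Real.add_one_le_exp (-κ)]) _
    rw [Real.log_mul (by positivity) hn0.ne', Real.log_pow, Real.log_pow, Real.log_exp,
      one_div, Real.log_inv] at h3
    have h4 : (k : ℝ) * Real.log 2 ≤ k * 1 :=
      mul_le_mul_of_nonneg_left (by linarith [Real.log_two_lt_d9]) (Nat.cast_nonneg _)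
    have h5 : κ * (θ * n - 2) ≤ κ * ((i + 1) * C) := by
      rw [div_lt_iff₀ (by linarith)] at hfl'
      exact mul_le_mul_of_nonneg_left hfl'.le hκ.le
    have h6 : κ * θ / (4 * C) * n * C = κ * θ * n / 4 := by
      field_simp
    have h7 : θ * (4 * C) ≤ κ := by rwa [le_div_iff₀ (by positivity)] at hθκ
    have h8 : θ * n * (θ * (4 * C)) ≤ θ * n * κ := mul_le_mul_of_nonneg_left h7 (by positivity)
    have h9 : (κ * i - Real.log n) * C ≤ k * C :=
      mul_le_mul_of_nonneg_right (by linarith) (by linarith)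
    have h10 : Real.log n * C ≤ κ * θ * n / 4 := by
      rw [← h6]
      exact mul_le_mul_of_nonneg_right h1 (by linarith)
    have h11 : κ * C ≤ 1 * C := mul_le_mul_of_nonneg_right hκ1 (by linarith)
    have h12 : 2 * θ ^ 2 * n * C ≤ k * C := by linarith
    exact le_of_mul_le_mul_right h12 (by linarith)

theorem Hypergraph3.isTightPath_of_tightList {V : Type*} {H : Hypergraph3 V} {x y z w : V}
    {P : List V} (hnd : P.Nodup) (hx : [x, y] <+: P) (hz : [z, w] <:+ P)
    (h : TightList H.Rel P) : H.IsTightPath x y z w P :=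
  ⟨hnd, hx, hz, fun _ _ _ hi => h.of_infix hi⟩

end AbsorbingPath

theorem mainTheorem6 :
    ∃ α₀ : ℝ, 0 < α₀ ∧ ∀ α : ℝ, 0 < α → α ≤ α₀ →
    ∃ ζ₀ : ℝ, 0 < ζ₀ ∧ ∀ ζ₁ : ℝ, 0 < ζ₁ → ζ₁ ≤ ζ₀ →
    ∀ β : ℝ, 0 < β → ∀ l : ℕ, 3 ≤ l → Odd l →
    ∃ θ₀ : ℝ, 0 < θ₀ ∧ ∀ θ₁ : ℝ, 0 < θ₁ → θ₁ ≤ θ₀ →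
    ∀ ζ₂ : ℝ, 0 < ζ₂ → ∀ θ₂ : ℝ, 0 < θ₂ →
    ∃ n₀ : ℕ, ∀ (V : Type*) [Finite V], n₀ ≤ Nat.card V →
    ∀ H : Hypergraph3 V,
    (5 / 9 + α) * ((Nat.card V : ℝ) ^ 2 / 2) ≤ (H.minDegree : ℝ) →
    ∀ R : ∀ v, (H.link v).Subgraph,
    (∀ v, (H.link v).IsRobustSubgraph α β l (R v)) →
    ∀ S : Set V, H.IsReservoir R l θ₁ ζ₂ θ₂ S →
    ∃ (x y z w : V) (P : List V),
      H.IsTightPath x y z w P ∧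
      Disjoint {v | v ∈ P} S ∧
      ({v | v ∈ P}.ncard : ℝ) ≤ θ₁ * (Nat.card V : ℝ) ∧
      H.IsConnectable R ζ₁ x y ∧
      H.IsConnectable R ζ₁ z w ∧
      ∀ X : Set V, X ⊆ {v | v ∈ P}ᶜ → (X.ncard : ℝ) ≤ 2 * θ₁ ^ 2 * (Nat.card V : ℝ) →
        ∃ Q : List V, H.IsTightPath x y z w Q ∧ {v | v ∈ Q} = {v | v ∈ P} ∪ X := by

  classical
  refine ⟨1 / 200000, by norm_num, fun α hα hα' => ⟨α / 100000000, by positivity, ?_⟩⟩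
  -- Oddness of the length gives the robust paths 2m interior vertices, an even number, as the
  -- weaving with m + 1 apexes requires.
  rintro ζ hζ hζ' β hβ l hl ⟨m, rfl⟩
  obtain ⟨c, hc⟩ : ∃ c : ℝ, c = 1 / 50000000 * ((α / 2) ^ 3 / 32) := ⟨_, rfl⟩
  have hc0 : 0 < c := by rw [hc]; positivity
  have hc1 : c ≤ 1 := by
    have h : (α / 2) ^ 3 ≤ 1 := pow_le_one₀ (by positivity) (by linarith)
    rw [hc]
    linarith
  obtain ⟨ε, hε, n₁, hn₁⟩ := exists_isAbsorbing α β ζ c hα hβ hζ hc0 m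
  -- The bounds 1 and ε/4 leave at most (ε/4)n each for the path and for the reservoir; the last
  -- bound lets linearly many absorbers beat 2θ²n.
  refine ⟨min (min 1 (ε / 4)) (c / 4 / (4 * ((12 * m + 17 : ℕ) : ℝ))), by positivity, ?_⟩
  intro θ hθ hθ' _ _ _ _
  have hθ1 : θ ≤ 1 := hθ'.trans ((min_le_left _ _).trans (min_le_left _ _))
  have hθε : θ ≤ ε / 4 := hθ'.trans ((min_le_left _ _).trans (min_le_right _ _))
  obtain ⟨n₂, hn₂⟩ := exists_number_of_absorbers (κ := c / 4) (C := 12 * m + 17) (by positivity)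
    (by linarith) (by omega) hθ (hθ'.trans (min_le_right _ _))
  obtain ⟨n₃, hn₃⟩ := exists_nat_gt (7 / (ε / 2))
  refine ⟨max 1 (max n₁ (max n₂ n₃)), ?_⟩
  intro V _ hn H hdeg R hR S hS
  have : Fintype V := Fintype.ofFinite V
  simp only [Nat.card_eq_fintype_card] at hn hdeg ⊢
  have : Nonempty V := Fintype.card_pos_iff.1 (by omega)
  have hnn : (n₃ : ℝ) ≤ Fintype.card V := by
    have : n₃ ≤ Fintype.card V := by omega
    exact_mod_cast this
  have h7 : 7 ≤ ε / 2 * Fintype.card V := by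
    rw [div_lt_iff₀ (by positivity)] at hn₃
    have := mul_le_mul_of_nonneg_left hnn (by positivity : 0 ≤ ε / 2)
    linarith
  obtain ⟨i, hi, hik⟩ := hn₂ (Fintype.card V) (by omega)
  have hScard := hS.card_le
  rw [Set.ncard_eq_toFinset_card', Nat.card_eq_fintype_card] at hScard
  have hθθ : θ ^ 2 * Fintype.card V ≤ ε / 4 * Fintype.card V := by
    refine mul_le_mul_of_nonneg_right ?_ (Nat.cast_nonneg _)
    have := mul_le_mul_of_nonneg_left hθ1 hθ.le
    linarith
  have hθε' : θ * Fintype.card V ≤ ε / 4 * Fintype.card V :=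
    mul_le_mul_of_nonneg_right hθε (Nat.cast_nonneg _)
  have hcount : ∀ v, c * (Fintype.card V : ℝ) ^ 9 ≤
      ((Finset.univ.filter fun t => H.IsAbsorber R ζ t ∧ v ∈ H.absorbed t).card : ℝ) := by
    intro v
    rw [hc]
    convert le_card_filter_isAbsorber hα hα' hζ.le hζ' hdeg hR v
  obtain ⟨x, y, z, w, P, A, hxy, hzw, hPA, hP, hPS, -, -, hPl, hpot⟩ := hn₁ V (by omega) H R hR
    (fun v => by convert hcount v) S.toFinset i (by
      push_cast at hi ⊢
      linarith)
  have habsorb : ∀ X : List V, X.Nodup → (∀ v ∈ X, v ∉ P) →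
      (X.length : ℝ) ≤ 2 * θ ^ 2 * Fintype.card V →
      ∃ Q : List V, H.IsTightPath x y z w Q ∧ Q.Perm (P ++ X) := by
    intro X hX hXP hXl
    -- The weight of a single vertex is at most the total potential, so every vertex has at least
    -- 2θ²n absorbers, enough for the greedy matching.
    obtain ⟨B, hB, hBX⟩ := exists_forall₂_reduceOption_perm A X (by
      intro v _
      have h1 : (1 / 2 : ℝ) ^ A.countP (fun S => decide (v ∈ S)) ≤ potential A := by
        refine le_trans ?_ (Finset.single_le_sum (fun v _ => by positivity) (Finset.mem_univ v))
        apply le_of_eq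
        congr!
      exact_mod_cast hXl.trans (hik _ (h1.trans hpot)))
    have hnd : (P ++ B.reduceOption).Nodup := by
      rw [(hBX.append_left P).nodup_iff, List.nodup_append']
      exact ⟨hP, hX, fun v hv hvX => hXP v hvX hv⟩
    obtain ⟨Q, hQ, hQx, hQz, hQP⟩ := hPA B hB hnd
    exact ⟨Q, Hypergraph3.isTightPath_of_tightList (hQP.nodup_iff.2 hnd) hQx hQz hQ,
      hQP.trans (hBX.append_left P)⟩
  -- `IsAbsorbing` does not assert that P itself is tight, so the path is obtained by absorbing the
  -- empty list; it has the same vertices as P.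
  obtain ⟨P₀, hP₀, hperm⟩ := habsorb [] List.nodup_nil (by simp) (by simp; positivity)
  rw [List.append_nil] at hperm
  have hset : {v | v ∈ P₀} = {v | v ∈ P} := Set.ext fun v => hperm.mem_iff
  refine ⟨x, y, z, w, P₀, hP₀, ?_, ?_, hxy, hzw, ?_⟩
  · rw [hset, Set.disjoint_left]
    intro v hv hvS
    exact hPS v hv (by simpa using hvS)
  · rw [hset]
    have h1 : ({v | v ∈ P} : Set V).ncard ≤ P.length := by
      rw [← List.coe_toFinset, Set.ncard_coe_finset]
      exact List.toFinset_card_le P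
    have h2 : (({v | v ∈ P} : Set V).ncard : ℝ) ≤ P.length := by exact_mod_cast h1
    rw [hPl] at h2
    push_cast at h2 hi
    linarith
  · intro X hXP hX
    rw [hset] at hXP ⊢
    obtain ⟨Q, hQ, hQP⟩ := habsorb X.toFinset.toList (Finset.nodup_toList _)
      (fun v hv => hXP (by simpa using hv)) (by
        rwa [Finset.length_toList, ← Set.ncard_eq_toFinset_card'])
    refine ⟨Q, hQ, Set.ext fun v => ?_⟩
    have := hQP.mem_iff (a := v)
    simpa using this
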